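/- Let $d\ge 3$. Let $\mathcal L_d$ be the class of functions $\varphi:[0,\infty)\to[0,1]$ that are continuous with $\varphi(0)=1$ and $\lim_{s\to\infty}\varphi(s)=0$, strictly decreasing on $[0,s_0]$ where $s_0=\inf\{s\ge 0:\varphi(s)=0\}\in(0,\infty]$ (on $[0,\infty)$ if $s_0=\infty$), differentiable on $(0,\infty)$ up to order $d-2$ with $(-1)^j\varphi^{(j)}\ge 0$ for $j=1,\dots,d-2$, and such that $(-1)^{d-2}\varphi^{(d-2)}$ is non-increasing and convex on $(0,\infty)$. For $\varphi\in\mathcal L_d$ let $U=(U_1,\dots,U_d)$ be a random vector with uniform$(0,1)$ margins whose distribution function is the Archimedean copula $$C(u_1,\dots,u_d)=\varphi\Big(\sum_{j=1}^d\varphi^{-1}(u_j)\Big),\qquad u\in(0,1]^d .$$ For disjoint $A,D\subseteq\{1,\dots,d\}$ with $D\neq\emptyset$, say that the conditional copula $C_{A\mid D}$ is constant if there is one copula which, for almost every value $x$ of $U_D$, couples the one-dimensional margins of the conditional distribution of $U_A$ given $U_D=x$. Say that $C$ is a simplified pair copula construction (simplified PCC) if $C_{\{i,j\}\mid D}$ is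 constant for all $i\ne j$ and all non-empty $D\subseteq\{1,\dots,d\}\setminus\{i,j\}$. If $d\ge 4$, then every $\varphi\in\mathcal L_d$ is twice continuously differentiable on $\{s>0:\varphi(s)>0\}$. Suppose that $\varphi\in\mathcal L_d$ is twice continuously differentiable on $\{s>0:\varphi(s)>0\}$. Then $C$ is a simplified PCC if and only if $\varphi$ belongs, up to a scaling of its argument, to the generalized MTCJ (Clayton) family, that is, if and only if there are $\theta\ge -\frac1{d-1}$ and $c>0$ with $$\varphi(s)=(1+\theta c s)_+^{-1/\theta}\quad\text{for all } s\ge 0,$$ where $(x)_+=\max\{0,x\}$ and the right-hand side is read as $e^{-cs}$ when $\theta=0$. This does not depend on which pair copula construction is considered: if $\varphi$ is of this form, then $C_{A\mid D}$ is constant for all disjoint $A,D$ with $|A|\ge 2$ and $D\ne\emptyset$, and conversely, if $C_{\{i,j\}\mid\{k\}}$ is constant for just one choice of distinct $i,j,k$, then $\varphi$ is of this form. -/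

import Mathlib

open MeasureTheory ProbabilityTheory Set Filter Topology

/-- The class `𝓛_d` of generators of `d`-dimensional Archimedean copulas (`d ≥ 2`), for functions
`φ : [0, ∞) → [0, 1]`; the values of `φ` on negative numbers play no role. Derivatives are taken
on the open half-line, so that `φ'(0+) = -∞` is allowed. -/
structure IsArchimedeanGenerator (d : ℕ) (φ : ℝ → ℝ) : Prop where
  mapsTo : MapsTo φ (Ici 0) (Icc 0 1)
  map_zero : φ 0 = 1
  tendsto_zero : Tendsto φ atTop (𝓝 0)
  continuousOn : ContinuousOn φ (Ici 0)
  /-- Strict decrease on `[0, s₀]`, `s₀ = inf {t ≥ 0 | φ t = 0} ∈ (0, ∞]`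
  (on `[0, ∞)` if `s₀ = ∞`). -/
  strictAntiOn : StrictAntiOn φ {s | 0 ≤ s ∧ ∀ t, 0 ≤ t → t < s → φ t ≠ 0}
  /-- The derivatives up to order `d - 2` exist on `(0, ∞)`. -/
  differentiableOn : ∀ j < d - 2, DifferentiableOn ℝ (iteratedDeriv j φ) (Ioi 0)
  sign_nonneg : ∀ j, 1 ≤ j → j ≤ d - 2 → ∀ s, 0 < s → 0 ≤ (-1 : ℝ) ^ j * iteratedDeriv j φ s
  antitoneOn : AntitoneOn (fun s => (-1 : ℝ) ^ (d - 2) * iteratedDeriv (d - 2) φ s) (Ioi 0)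
  convexOn : ConvexOn ℝ (Ioi 0) (fun s => (-1 : ℝ) ^ (d - 2) * iteratedDeriv (d - 2) φ s)

/-- `φ` is twice continuously differentiable where it is positive
(interior points `s > 0` of its domain). -/
def IsC2WherePos (φ : ℝ → ℝ) : Prop :=
  ContDiffOn ℝ 2 φ {s | 0 < s ∧ 0 < φ s}

/-- The inverse `φ⁻¹(u)` of a generator; it is only used for `0 < u ≤ 1`. -/
noncomputable def generatorInv (φ : ℝ → ℝ) (u : ℝ) : ℝ :=
  sInf {s | 0 ≤ s ∧ φ s = u}

/-- `ν` is a probability law whose one-dimensional margins are uniform on `(0, 1)`. -/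
structure IsCopulaLaw {ι : Type*} (ν : Measure (ι → ℝ)) : Prop where
  isProbabilityMeasure : IsProbabilityMeasure ν
  map_eval : ∀ i, ν.map (fun z => z i) = volume.restrict (Ioo 0 1)

/-- A copula: the distribution function of a law with uniform margins. -/
def IsCopula {ι : Type*} (C : (ι → ℝ) → ℝ) : Prop :=
  ∃ ν : Measure (ι → ℝ), IsCopulaLaw ν ∧ ∀ u, C u = ν.real (Iic u)

/-- `μ` is the law of the Archimedean copula with generator `φ`: it has uniform margins and its
distribution function is `φ (∑ φ⁻¹(u_j))` for `u ∈ (0, 1]^d` (and hence `0` as soon as some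
`u_j ≤ 0`). -/
structure IsArchimedeanCopulaLaw {d : ℕ} (φ : ℝ → ℝ) (μ : Measure (Fin d → ℝ)) : Prop where
  isCopulaLaw : IsCopulaLaw μ
  cdf_eq : ∀ u : Fin d → ℝ, (∀ j, u j ∈ Ioc (0 : ℝ) 1) →
    μ.real (Iic u) = φ (∑ j, generatorInv φ (u j))

/-- `C` couples the margins of `ν`: `F(y) = C(F_1(y_1), …, F_n(y_n))` for all `y`. -/
def Couples {ι : Type*} (C : (ι → ℝ) → ℝ) (ν : Measure (ι → ℝ)) : Prop :=
  ∀ y : ι → ℝ, ν.real (Iic y) = C (fun i => ν.real {z | z i ≤ y i})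

/-- The copula of the conditional distribution of `X_A` given `X_D = x`, where `X` has law `μ`,
does not depend on `x`: one copula couples the margins of the regular conditional distribution
for almost every value `x` of `X_D`. -/
def ConditionalCopulaConstant {d : ℕ} (μ : Measure (Fin d → ℝ)) [IsFiniteMeasure μ]
    (A D : Finset (Fin d)) : Prop :=
  ∃ C : (A → ℝ) → ℝ, IsCopula C ∧
    ∀ᵐ x ∂(μ.map (fun z => D.restrict z)),
      Couples C (condDistrib (fun z : Fin d → ℝ => A.restrict z) (fun z => D.restrict z) μ x)

/-- `μ` is a simplified pair copula construction: no bivariate conditional copula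
`C_{ij|D}` depends on the value of the conditioning variables `X_D`. -/
def IsSimplifiedPCC {d : ℕ} (μ : Measure (Fin d → ℝ)) [IsFiniteMeasure μ] : Prop :=
  ∀ A D : Finset (Fin d), A.card = 2 → D.Nonempty → Disjoint A D →
    ConditionalCopulaConstant μ A D

/-- The (generalized) gamma Laplace transform `(1 + θ s)_+ ^ (-1/θ)`, read as its limit `exp (-s)`
for `θ = 0`. -/
noncomputable def mtcjGenerator (θ s : ℝ) : ℝ :=
  if θ = 0 then Real.exp (-s) else (max 0 (1 + θ * s)) ^ (-1 / θ)

/-- `φ` belongs to the generalized MTCJ (Clayton) family in dimension `d`. A generator is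
determined by its copula only up to a scale factor `c > 0` of the argument. -/
def IsMTCJ (d : ℕ) (φ : ℝ → ℝ) : Prop :=
  ∃ θ c : ℝ, -1 / ((d : ℝ) - 1) ≤ θ ∧ 0 < c ∧ ∀ s, 0 ≤ s → φ s = mtcjGenerator θ (c * s)

/-! Put X_i = φ⁻¹(U_i). The joint survival function of X is φ(x_1 + ... + x_d), so with f = -φ' the
law of the remaining coordinates given X_k = t has survival function f(t + Σ y_i) / f(t). It is
again of Archimedean type, with the normalized tail H_t(s) = f(t + s) / f(t) as generator. As a
generator is determined by its copula up to scale, a constant conditional copula means that all the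
tails H_t are rescalings of each other.

For the Clayton family this holds because 1 + b(t + s) = (1 + bt)(1 + b s/(1 + bt))
(`claytonPow_add`). Each conditioning lowers the exponent by one and rescales by 1 + bt. By
induction on D, the vector X_{Dᶜ} / (1 + b Σ_D X) is independent of X_D (`indepFun_rescaledCoords`).
Hence, given U_D, the vector U_A is a coordinatewise increasing image of a vector of uniforms
independent of U_D, and the copula of those uniforms is the conditional copula
(`IsArchimedeanCopulaLaw.conditionalCopulaConstant`).

Conversely, let the copula of a pair given one variable be constant. Then almost all H_t generate
the same copula, and comparing derivatives at 0 identifies the scale as q = f/g with g = φ''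
(`IsSurvival.mul_eq_mul_of_copula_eq`). Continuity of g extends the relation to all t
(`IsSmoothSurvival.tail_eq_of_copula`). The scale q is then affine: if φ reaches 0, compare the
endpoints of the tails (`exists_affine_of_endpoint`); otherwise, differentiating the relation leads
to the Gołąb–Schinzel equation (`golab_schinzel`, `exists_affine_of_pos`). From f = g · (α + βt) it
follows that f · (α + βt) - (1 - β)φ is constant, and the constant is 0 by its value at the endpoint
or its limit at infinity. The resulting linear first-order equation for φ integrates to a power or
an exponential. The bound on θ < 0 comes from the order of differentiability and the convexity
required at the endpoint (`IsArchimedeanGenerator.le_exponent`). -/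

/-! ### Survival functions on the half-line -/

/-- `φ` is a continuous survival function on `[0, ∞)` that strictly decreases while positive. -/
structure IsSurvival (φ : ℝ → ℝ) : Prop where
  nonneg : ∀ s, 0 ≤ s → 0 ≤ φ s
  map_zero : φ 0 = 1
  continuousOn : ContinuousOn φ (Ici 0)
  tendsto_zero : Tendsto φ atTop (𝓝 0)
  antitoneOn : AntitoneOn φ (Ici 0)
  lt_of_lt : ∀ s t, 0 ≤ s → s < t → 0 < φ s → φ t < φ s

/-- `φ` is the survival function on `[0, ∞)` of a law with continuous density `f`. -/
structure HasSurvivalDensity (φ f : ℝ → ℝ) : Prop where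
  map_zero : φ 0 = 1
  continuousOn : ContinuousOn φ (Ici 0)
  tendsto_zero : Tendsto φ atTop (𝓝 0)
  hasDerivAt : ∀ s, 0 < s → HasDerivAt φ (-f s) s
  density_nonneg : ∀ s, 0 < s → 0 ≤ f s
  density_continuousOn : ContinuousOn f (Ioi 0)

/-- The inverse of a survival function on `(0, 1)`, extended by `0`. -/
noncomputable def survivalInv (φ : ℝ → ℝ) (u : ℝ) : ℝ :=
  (Ioo (0 : ℝ) 1).indicator (generatorInv φ) u

namespace IsSurvival

variable {φ : ℝ → ℝ}

theorem le_one (h : IsSurvival φ) {s : ℝ} (hs : 0 ≤ s) : φ s ≤ 1 :=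
  h.map_zero ▸ h.antitoneOn (mem_Ici.2 le_rfl) hs hs

theorem exists_eq (h : IsSurvival φ) {u : ℝ} (hu : u ∈ Ioc (0 : ℝ) 1) : ∃ s, 0 ≤ s ∧ φ s = u := by
  obtain ⟨b, hb0, hb⟩ : ∃ b, 0 ≤ b ∧ φ b < u :=
    ((eventually_ge_atTop 0).and (h.tendsto_zero.eventually_lt_const hu.1)).exists
  have := intermediate_value_Icc' hb0 (h.continuousOn.mono Icc_subset_Ici_self)
  obtain ⟨s, hs, rfl⟩ := this ⟨hb.le, h.map_zero.symm ▸ hu.2⟩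
  exact ⟨s, hs.1, rfl⟩

theorem injOn (h : IsSurvival φ) {s t : ℝ} (hs : 0 ≤ s) (ht : 0 ≤ t) (hpos : 0 < φ s)
    (heq : φ s = φ t) : s = t := by
  rcases lt_trichotomy s t with hlt | rfl | hlt
  · exact absurd (h.lt_of_lt s t hs hlt hpos) (by simp [heq])
  · rfl
  · exact absurd (h.lt_of_lt t s ht hlt (heq ▸ hpos)) (by simp [heq])

theorem generatorInv_apply (h : IsSurvival φ) {s : ℝ} (hs : 0 ≤ s) (hpos : 0 < φ s) :
    generatorInv φ (φ s) = s := by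
  have : {t | 0 ≤ t ∧ φ t = φ s} = {s} := by
    ext t
    constructor
    · rintro ⟨ht, hts⟩
      exact (h.injOn hs ht hpos hts.symm).symm
    · rintro rfl
      exact ⟨hs, rfl⟩
  rw [generatorInv, this, csInf_singleton]

theorem apply_survivalInv (h : IsSurvival φ) {u : ℝ} (hu : u ∈ Ioo (0 : ℝ) 1) :
    φ (survivalInv φ u) = u := by
  obtain ⟨s, hs, rfl⟩ := h.exists_eq ⟨hu.1, hu.2.le⟩
  rw [survivalInv, indicator_of_mem hu, h.generatorInv_apply hs hu.1]

theorem survivalInv_apply (h : IsSurvival φ) {s : ℝ} (hs : 0 ≤ s) (hpos : φ s ∈ Ioo (0 : ℝ) 1) :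
    survivalInv φ (φ s) = s := by
  rw [survivalInv, indicator_of_mem hpos, h.generatorInv_apply hs hpos.1]

theorem survivalInv_nonneg (φ : ℝ → ℝ) (u : ℝ) : 0 ≤ survivalInv φ u := by
  refine indicator_nonneg (fun u _ => Real.sInf_nonneg fun s hs => hs.1) u

/-- Translates upper orthants for X = φ⁻¹(U) into lower orthants for U, so that a distribution
function becomes a survival function. -/
theorem le_survivalInv_iff (h : IsSurvival φ) {u s : ℝ} (hu : u ∈ Ioo (0 : ℝ) 1) (hs : 0 ≤ s) :
    s ≤ survivalInv φ u ↔ u ≤ φ s := by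
  constructor
  · intro hle
    have := h.antitoneOn hs (mem_Ici.2 (survivalInv_nonneg φ u)) hle
    rwa [h.apply_survivalInv hu] at this
  · intro hle
    by_contra! hlt
    have := h.lt_of_lt _ _ (survivalInv_nonneg φ u) hlt (by rw [h.apply_survivalInv hu]; exact hu.1)
    rw [h.apply_survivalInv hu] at this
    exact absurd hle this.not_ge

theorem antitoneOn_survivalInv (h : IsSurvival φ) : AntitoneOn (survivalInv φ) (Ioo 0 1) := by
  intro u hu v hv huv
  rw [h.le_survivalInv_iff hu (survivalInv_nonneg φ v), h.apply_survivalInv hv]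
  exact huv

theorem measurable_survivalInv (h : IsSurvival φ) : Measurable (survivalInv φ) := by
  refine measurable_of_restrict_of_restrict_compl (measurableSet_Ioo (a := (0 : ℝ)) (b := 1)) ?_ ?_
  · refine Antitone.measurable fun u v huv => ?_
    exact h.antitoneOn_survivalInv u.2 v.2 huv
  · have : domRestrict (Ioo (0 : ℝ) 1)ᶜ (survivalInv φ) = fun _ => 0 := by
      ext u
      exact indicator_of_notMem u.2 _
    rw [this]
    exact measurable_const

/-- The values of φ at negative arguments are arbitrary; clamping at 0 gives a continuous, hence
measurable, function on the whole line. -/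
theorem continuous_comp_max (h : IsSurvival φ) : Continuous fun s => φ (max s 0) :=
  h.continuousOn.comp_continuous (by fun_prop) fun s => le_max_right s 0

end IsSurvival

namespace HasSurvivalDensity

variable {φ f : ℝ → ℝ}

theorem continuousWithinAt (h : HasSurvivalDensity φ f) {a : ℝ} (ha : 0 ≤ a) :
    ContinuousWithinAt φ (Ici a) a :=
  (h.continuousOn a ha).mono (Ici_subset_Ici.2 ha)

theorem integrableOn (h : HasSurvivalDensity φ f) {a : ℝ} (ha : 0 ≤ a) :
    IntegrableOn f (Ioi a) := by
  have := integrableOn_Ioi_deriv_of_nonpos (h.continuousWithinAt ha)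
    (fun x hx => h.hasDerivAt x (ha.trans_lt hx))
    (fun x hx => neg_nonpos.2 (h.density_nonneg x (ha.trans_lt hx))) h.tendsto_zero
  simpa using this.neg

theorem lintegral_Ioi (h : HasSurvivalDensity φ f) {a : ℝ} (ha : 0 ≤ a) :
    ∫⁻ t in Ioi a, ENNReal.ofReal (f t) = ENNReal.ofReal (φ a) := by
  have := integral_Ioi_of_hasDerivAt_of_nonpos (h.continuousWithinAt ha)
    (fun x hx => h.hasDerivAt x (ha.trans_lt hx))
    (fun x hx => neg_nonpos.2 (h.density_nonneg x (ha.trans_lt hx))) h.tendsto_zero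
  rw [integral_neg, zero_sub, neg_inj] at this
  rw [← this, ofReal_integral_eq_lintegral_ofReal (h.integrableOn ha)]
  filter_upwards [ae_restrict_mem measurableSet_Ioi] with t ht
  exact h.density_nonneg t (ha.trans_lt ht)

theorem lintegral_Ioi_add (h : HasSurvivalDensity φ f) {a s : ℝ} (ha : 0 ≤ a) (hs : 0 ≤ s) :
    ∫⁻ t in Ioi a, ENNReal.ofReal (f (t + s)) = ENNReal.ofReal (φ (a + s)) := by
  rw [← h.lintegral_Ioi (add_nonneg ha hs)]
  have := (measurePreserving_add_right (volume : Measure ℝ) s).setLIntegral_comp_preimage_emb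
    (MeasurableEquiv.addRight s).measurableEmbedding (fun t => ENNReal.ofReal (f t)) (Ioi (a + s))
  simpa using this

theorem antitoneOn (h : HasSurvivalDensity φ f) : AntitoneOn φ (Ici 0) := by
  refine antitoneOn_of_deriv_nonpos (convex_Ici 0) h.continuousOn ?_ ?_
  · rw [interior_Ici]
    exact fun s hs => (h.hasDerivAt s hs).differentiableAt.differentiableWithinAt
  · rw [interior_Ici]
    intro s hs
    rw [(h.hasDerivAt s hs).deriv]
    exact neg_nonpos.2 (h.density_nonneg s hs)

theorem nonneg (h : HasSurvivalDensity φ f) {s : ℝ} (hs : 0 ≤ s) : 0 ≤ φ s := by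
  refine le_of_tendsto h.tendsto_zero ?_
  filter_upwards [eventually_ge_atTop s] with t ht
  exact h.antitoneOn hs (mem_Ici.2 (hs.trans ht)) ht

end HasSurvivalDensity

/-! ### Archimedean generators -/

namespace IsArchimedeanGenerator

variable {d : ℕ} {φ : ℝ → ℝ}

theorem hasDerivAt_iteratedDeriv (h : IsArchimedeanGenerator d φ) {j : ℕ} (hj : j < d - 2) {s : ℝ}
    (hs : 0 < s) : HasDerivAt (iteratedDeriv j φ) (iteratedDeriv (j + 1) φ s) s := by
  rw [iteratedDeriv_succ]
  exact ((h.differentiableOn j hj).differentiableAt (Ioi_mem_nhds hs)).hasDerivAt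

/-- The function (-1)^(d-2) φ^(d-2) has derivative -(-1)^(d-1) φ^(d-1), which is nonpositive and
nondecreasing by the assumptions of order d + 1. -/
theorem of_succ (hd : 3 ≤ d) (h : IsArchimedeanGenerator (d + 1) φ) :
    IsArchimedeanGenerator d φ := by
  have hder : ∀ s, 0 < s → HasDerivAt (fun s => (-1 : ℝ) ^ (d - 2) * iteratedDeriv (d - 2) φ s)
      (-((-1 : ℝ) ^ (d - 1) * iteratedDeriv (d - 1) φ s)) s := by
    intro s hs
    have := (h.hasDerivAt_iteratedDeriv (j := d - 2) (by omega) hs).const_mul ((-1 : ℝ) ^ (d - 2))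
    rw [show d - 2 + 1 = d - 1 by omega] at this
    convert! this using 1
    rw [show d - 1 = d - 2 + 1 by omega, pow_succ]
    ring
  have e1 : d + 1 - 2 = d - 1 := by omega
  have hcont : ContinuousOn (fun s => (-1 : ℝ) ^ (d - 2) * iteratedDeriv (d - 2) φ s) (Ioi 0) :=
    fun s hs => (hder s hs).continuousAt.continuousWithinAt
  have hdiff : DifferentiableOn ℝ (fun s => (-1 : ℝ) ^ (d - 2) * iteratedDeriv (d - 2) φ s)
      (Ioi 0) := fun s hs => (hder s hs).differentiableAt.differentiableWithinAt
  refine ⟨h.mapsTo, h.map_zero, h.tendsto_zero, h.continuousOn, h.strictAntiOn,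
    fun j hj => h.differentiableOn j (by omega), fun j h1 h2 => h.sign_nonneg j h1 (by omega),
    ?_, ?_⟩
  · refine antitoneOn_of_deriv_nonpos (convex_Ioi 0) hcont ?_ ?_
    · rwa [interior_Ioi]
    · rw [interior_Ioi]
      intro s hs
      rw [(hder s hs).deriv, neg_nonpos]
      exact h.sign_nonneg _ (by omega) (by omega) s hs
  · refine MonotoneOn.convexOn_of_deriv (convex_Ioi 0) hcont ?_ ?_
    · rwa [interior_Ioi]
    · rw [interior_Ioi]
      intro s hs t ht hst
      rw [(hder s hs).deriv, (hder t ht).deriv]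
      have := h.antitoneOn hs ht hst
      rw [e1] at this
      exact neg_le_neg this

theorem of_le {e : ℕ} (he : 3 ≤ e) (hed : e ≤ d) (h : IsArchimedeanGenerator d φ) :
    IsArchimedeanGenerator e φ := by
  induction d, hed using Nat.le_induction with
  | base => exact h
  | succ n hn ih => exact ih (h.of_succ (he.trans hn))

theorem hasDerivAt (hd : 3 ≤ d) (h : IsArchimedeanGenerator d φ) {s : ℝ} (hs : 0 < s) :
    HasDerivAt φ (deriv φ s) s := by
  simpa using h.hasDerivAt_iteratedDeriv (j := 0) (by omega) hs

theorem convexOn_neg_deriv (hd : 3 ≤ d) (h : IsArchimedeanGenerator d φ) :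
    ConvexOn ℝ (Ioi 0) (fun s => -deriv φ s) := by
  have := (h.of_le le_rfl hd).convexOn
  simpa using this

theorem antitoneOn_neg_deriv (hd : 3 ≤ d) (h : IsArchimedeanGenerator d φ) :
    AntitoneOn (fun s => -deriv φ s) (Ioi 0) := by
  have := (h.of_le le_rfl hd).antitoneOn
  simpa using this

theorem hasSurvivalDensity (hd : 3 ≤ d) (h : IsArchimedeanGenerator d φ) :
    HasSurvivalDensity φ (fun s => -deriv φ s) where
  map_zero := h.map_zero
  continuousOn := h.continuousOn
  tendsto_zero := h.tendsto_zero
  hasDerivAt s hs := by simpa using h.hasDerivAt hd hs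
  density_nonneg s hs := by simpa using h.sign_nonneg 1 le_rfl (by omega) s hs
  density_continuousOn := (h.convexOn_neg_deriv hd).continuousOn isOpen_Ioi

theorem isSurvival (hd : 3 ≤ d) (h : IsArchimedeanGenerator d φ) : IsSurvival φ where
  nonneg s hs := (h.mapsTo hs).1
  map_zero := h.map_zero
  continuousOn := h.continuousOn
  tendsto_zero := h.tendsto_zero
  antitoneOn := (h.hasSurvivalDensity hd).antitoneOn
  lt_of_lt s t hs hst hpos := by
    have hanti := (h.hasSurvivalDensity hd).antitoneOn
    have ht : 0 ≤ t := hs.trans hst.le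
    rcases (h.mapsTo (mem_Ici.2 ht)).1.eq_or_lt with h0 | h0
    · rwa [← h0]
    · have key : ∀ x, 0 ≤ x → x ≤ t → 0 < φ x := fun x hx hxt => h0.trans_le (hanti hx ht hxt)
      exact h.strictAntiOn ⟨hs, fun x hx hxs => (key x hx (hxs.le.trans hst.le)).ne'⟩
        ⟨ht, fun x hx hxs => (key x hx hxs.le).ne'⟩ hst

/-- A convex function on an open interval is continuous, and in dimension 4 this applies to φ''
itself. -/
theorem isC2WherePos (hd : 4 ≤ d) (h : IsArchimedeanGenerator d φ) : IsC2WherePos φ := by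
  have h4 := h.of_le (by norm_num : 3 ≤ 4) hd
  have hcont : ContinuousOn (deriv (deriv φ)) (Ioi 0) := by
    have := h4.convexOn.continuousOn isOpen_Ioi
    simpa [iteratedDeriv_succ] using this
  have hdiff : DifferentiableOn ℝ (deriv φ) (Ioi 0) := by
    have := h4.differentiableOn 1 (by norm_num)
    simpa using this
  have hdiff0 : DifferentiableOn ℝ φ (Ioi 0) := by
    have := h4.differentiableOn 0 (by norm_num)
    simpa using this
  have h2 : ContDiffOn ℝ 2 φ (Ioi 0) := by
    rw [show (2 : WithTop ℕ∞) = 1 + 1 by norm_num, contDiffOn_succ_iff_deriv_of_isOpen isOpen_Ioi]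
    refine ⟨hdiff0, by simp, ?_⟩
    rw [show (1 : WithTop ℕ∞) = 0 + 1 by norm_num, contDiffOn_succ_iff_deriv_of_isOpen isOpen_Ioi]
    exact ⟨hdiff, by simp, by simpa using hcont⟩
  exact h2.mono fun s hs => hs.1

end IsArchimedeanGenerator

/-! ### Conditional distributions from joint survival functions -/

/-- Closed upper orthants form a π-system generating the Borel sets; equality of total masses is
assumed separately. -/
theorem MeasureTheory.Measure.ext_of_Ici_pi {ι : Type*} [Fintype ι] {μ ν : Measure (ι → ℝ)}
    [IsFiniteMeasure μ] (huniv : μ univ = ν univ) (h : ∀ a, μ (Ici a) = ν (Ici a)) : μ = ν := by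
  refine ext_of_generate_finite (pi univ '' pi univ fun _ : ι => range (Ici : ℝ → Set ℝ)) ?_ ?_ ?_
    huniv
  · refine (generateFrom_eq_pi (fun _ => ?_) fun _ => ?_).symm
    · exact (borel_eq_generateFrom_Ici ℝ).symm.trans (BorelSpace.measurable_eq (α := ℝ)).symm
    · refine ⟨fun n : ℕ => Ici (-(n : ℝ)), fun n => ⟨_, rfl⟩, ?_⟩
      refine eq_univ_of_forall fun x => ?_
      obtain ⟨n, hn⟩ := exists_nat_ge (-x)
      exact mem_iUnion.2 ⟨n, by simpa using neg_le.1 hn⟩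
  · exact IsPiSystem.pi fun _ => isPiSystem_Ici
  · rintro _ ⟨s, hs, rfl⟩
    choose a ha using fun i => hs i (mem_univ i)
    have : s = fun i => Ici (a i) := funext fun i => (ha i).symm
    rw [this, pi_univ_Ici]
    exact h a

theorem ae_of_measureReal_eq_one {Ω : Type*} [MeasurableSpace Ω] {P : Measure Ω}
    [IsProbabilityMeasure P] {p : Ω → Prop} (hp : MeasurableSet {ω | p ω})
    (h : P.real {ω | p ω} = 1) : ∀ᵐ ω ∂P, p ω := by
  refine (mem_ae_iff_prob_eq_one hp).2 ?_
  rw [← ofReal_measureReal, h, ENNReal.ofReal_one]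

theorem measurableSet_Ici_pi {ι : Type*} [Fintype ι] (y : ι → ℝ) : MeasurableSet (Ici y) :=
  isClosed_Ici.measurableSet

section

variable {ι Ω : Type*} [Fintype ι] [MeasurableSpace Ω] {P : Measure Ω} [IsProbabilityMeasure P]
  {T : Ω → ℝ} {Y : Ω → ι → ℝ} {φ f : ℝ → ℝ}

/-- On the event `y ≤ Y`, the law of `T` has density `f (· + ∑ y_i)` on `(0, ∞)`. -/
theorem HasSurvivalDensity.map_restrict_eq (h : HasSurvivalDensity φ f) (hT : Measurable T)
    (hY : Measurable Y)
    (hS : ∀ t y, 0 ≤ t → 0 ≤ y → P.real {ω | t ≤ T ω ∧ y ≤ Y ω} = φ (t + ∑ i, y i))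
    {y : ι → ℝ} (hy : 0 ≤ y) :
    (P.restrict (Y ⁻¹' Ici y)).map T =
      (volume.restrict (Ioi 0)).withDensity fun t => ENNReal.ofReal (f (t + ∑ i, y i)) := by
  have hs : 0 ≤ ∑ i, y i := Finset.sum_nonneg fun i _ => hy i
  have key : ∀ t, 0 ≤ t → P (T ⁻¹' Ici t ∩ Y ⁻¹' Ici y) = ENNReal.ofReal (φ (t + ∑ i, y i)) := by
    intro t ht
    rw [← hS t y ht hy, ofReal_measureReal]
    rfl
  have hT0 : ∀ᵐ ω ∂P, 0 ≤ T ω := by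
    have h1 : P.real {ω | 0 ≤ T ω ∧ (0 : ι → ℝ) ≤ Y ω} = 1 := by
      rw [hS 0 0 le_rfl le_rfl]
      simp [h.map_zero]
    exact (ae_of_measureReal_eq_one
      ((hT measurableSet_Ici).inter (hY (measurableSet_Ici_pi 0))) h1).mono fun ω hω => hω.1
  refine Measure.ext_of_Ici _ _ fun a => ?_
  rw [Measure.map_apply hT measurableSet_Ici, Measure.restrict_apply (hT measurableSet_Ici),
    withDensity_apply _ measurableSet_Ici, Measure.restrict_restrict measurableSet_Ici]
  have h1 : P (T ⁻¹' Ici a ∩ Y ⁻¹' Ici y) = P (T ⁻¹' Ici (max a 0) ∩ Y ⁻¹' Ici y) := by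
    refine measure_congr ?_
    refine eventuallyEq_set.2 ?_
    filter_upwards [hT0] with ω hω
    simp [hω]
  have h2 : (Ici a ∩ Ioi 0 : Set ℝ) =ᵐ[volume] Ioi (max a 0) := by
    refine Filter.EventuallyEq.trans (Ioi_ae_eq_Ici.symm.inter (ae_eq_refl _)) ?_
    rw [Ioi_inter_Ioi]
    exact ae_eq_refl _
  rw [h1, key _ (le_max_right _ _), setLIntegral_congr h2,
    h.lintegral_Ioi_add (le_max_right _ _) hs]

/-- The law with survival function `φ` has density `f` on `(0, ∞)`. -/
theorem HasSurvivalDensity.map_eq (h : HasSurvivalDensity φ f) (hT : Measurable T)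
    (hY : Measurable Y)
    (hS : ∀ t y, 0 ≤ t → 0 ≤ y → P.real {ω | t ≤ T ω ∧ y ≤ Y ω} = φ (t + ∑ i, y i)) :
    P.map T = (volume.restrict (Ioi 0)).withDensity fun t => ENNReal.ofReal (f t) := by
  have hY0 : ∀ᵐ ω ∂P, ω ∈ Y ⁻¹' Ici 0 := by
    have h1 : P.real {ω | 0 ≤ T ω ∧ (0 : ι → ℝ) ≤ Y ω} = 1 := by
      rw [hS 0 0 le_rfl le_rfl]
      simp [h.map_zero]
    exact (ae_of_measureReal_eq_one
      ((hT measurableSet_Ici).inter (hY (measurableSet_Ici_pi 0))) h1).mono fun ω hω => hω.2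
  have := h.map_restrict_eq hT hY hS le_rfl
  rw [Measure.restrict_eq_self_of_ae_mem hY0] at this
  simpa using this

theorem HasSurvivalDensity.aemeasurable (h : HasSurvivalDensity φ f) {s : ℝ} (hs : 0 ≤ s) :
    AEMeasurable (fun t => ENNReal.ofReal (f (t + s))) (volume.restrict (Ioi 0)) := by
  refine AEMeasurable.ennreal_ofReal (ContinuousOn.aemeasurable ?_ measurableSet_Ioi)
  exact h.density_continuousOn.comp (by fun_prop) fun t ht => add_pos_of_pos_of_nonneg ht hs

/-- The conditional survival function of `Y` given `T = t` at a fixed point. -/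
theorem HasSurvivalDensity.condDistrib_Ici_aux (h : HasSurvivalDensity φ f) (hT : Measurable T)
    (hY : Measurable Y)
    (hS : ∀ t y, 0 ≤ t → 0 ≤ y → P.real {ω | t ≤ T ω ∧ y ≤ Y ω} = φ (t + ∑ i, y i))
    {y : ι → ℝ} (hy : 0 ≤ y) :
    ∀ᵐ t ∂(volume.restrict (Ioi 0)),
      ENNReal.ofReal (f t) * condDistrib Y T P t (Ici y) = ENNReal.ofReal (f (t + ∑ i, y i)) := by
  have hs : 0 ≤ ∑ i, y i := Finset.sum_nonneg fun i _ => hy i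
  have hm' : Measurable fun t => condDistrib Y T P t (Ici y) :=
    Kernel.measurable_coe _ (measurableSet_Ici_pi y)
  have hf0 : AEMeasurable (fun t => ENNReal.ofReal (f t)) (volume.restrict (Ioi 0)) := by
    simpa using h.aemeasurable le_rfl
  -- Both sides are the law of T on the event y ≤ Y. Writing each with a density with respect to
  -- Lebesgue measure and comparing densities yields the claim.
  have h1 : (P.restrict (Y ⁻¹' Ici y)).map T =
      (P.map T).withDensity fun t => condDistrib Y T P t (Ici y) := by
    ext B hB
    rw [withDensity_apply _ hB, setLIntegral_map hB hm' hT,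
      setLIntegral_preimage_condDistrib hT hY.aemeasurable (measurableSet_Ici_pi y) hB,
      Measure.map_apply hT hB, Measure.restrict_apply (hT hB)]
  rw [h.map_restrict_eq hT hY hS hy, h.map_eq hT hY hS,
    ← withDensity_mul₀ hf0 hm'.aemeasurable] at h1
  refine ((withDensity_eq_iff (h.aemeasurable hs) (hf0.mul hm'.aemeasurable) ?_).1 h1).symm
  rw [h.lintegral_Ioi_add le_rfl hs]
  exact ENNReal.ofReal_ne_top

/-- The conditional survival function of `Y` given `T = t`. -/
theorem HasSurvivalDensity.condDistrib_Ici (h : HasSurvivalDensity φ f) (hT : Measurable T)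
    (hY : Measurable Y)
    (hS : ∀ t y, 0 ≤ t → 0 ≤ y → P.real {ω | t ≤ T ω ∧ y ≤ Y ω} = φ (t + ∑ i, y i)) :
    ∀ᵐ t ∂(P.map T), 0 < t ∧ 0 < f t ∧
      ∀ y, 0 ≤ y → (condDistrib Y T P t).real (Ici y) = f (t + ∑ i, y i) / f t := by
  have hf0 : AEMeasurable (fun t => ENNReal.ofReal (f t)) (volume.restrict (Ioi 0)) := by
    simpa using h.aemeasurable le_rfl
  -- The exceptional null set depends on y. The countable grid of points k/n yields one null set;
  -- monotonicity in y and continuity of f then reach every y, by rounding down and up.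
  have hgrid : ∀ᵐ t ∂(volume.restrict (Ioi 0)), ∀ (n : ℕ) (k : ι → ℕ),
      ENNReal.ofReal (f t) * condDistrib Y T P t (Ici fun i => (k i : ℝ) / n) =
        ENNReal.ofReal (f (t + ∑ i, (k i : ℝ) / n)) := by
    rw [ae_all_iff]
    intro n
    rw [ae_all_iff]
    intro k
    exact h.condDistrib_Ici_aux hT hY hS fun i => by positivity
  rw [h.map_eq hT hY hS, ae_withDensity_iff' hf0]
  filter_upwards [hgrid, ae_restrict_mem measurableSet_Ioi] with t ht ht0 hft
  have ht0 : 0 < t := ht0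
  have hft : 0 < f t := by
    by_contra! hle
    exact hft (ENNReal.ofReal_of_nonpos hle)
  refine ⟨ht0, hft, fun y hy => ?_⟩
  have hgrid' : ∀ (n : ℕ) (k : ι → ℕ), (condDistrib Y T P t).real (Ici fun i => (k i : ℝ) / n) =
      f (t + ∑ i, (k i : ℝ) / n) / f t := by
    intro n k
    have hpos : 0 < t + ∑ i, (k i : ℝ) / n :=
      add_pos_of_pos_of_nonneg ht0 (Finset.sum_nonneg fun i _ => by positivity)
    rw [eq_div_iff hft.ne', mul_comm, ← ENNReal.toReal_ofReal hft.le, Measure.real,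
      ← ENNReal.toReal_mul, ht, ENNReal.toReal_ofReal (h.density_nonneg _ hpos)]
  have hlim : ∀ g : ℕ → ι → ℝ, (∀ i, Tendsto (fun n => g n i) atTop (𝓝 (y i))) →
      Tendsto (fun n => f (t + ∑ i, g n i) / f t) atTop (𝓝 (f (t + ∑ i, y i) / f t)) := by
    intro g hg
    have hpos : 0 < t + ∑ i, y i :=
      add_pos_of_pos_of_nonneg ht0 (Finset.sum_nonneg fun i _ => hy i)
    have hc : ContinuousAt f (t + ∑ i, y i) :=
      h.density_continuousOn.continuousAt (Ioi_mem_nhds hpos)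
    exact (hc.tendsto.comp ((tendsto_finsetSum _ fun i _ => hg i).const_add t)).div_const _
  have hlo := hlim (fun n i => (⌊y i * n⌋₊ : ℝ) / n) fun i =>
    (tendsto_nat_floor_mul_div_atTop (hy i)).comp tendsto_natCast_atTop_atTop
  have hhi := hlim (fun n i => (⌈y i * n⌉₊ : ℝ) / n) fun i =>
    (tendsto_nat_ceil_mul_div_atTop (hy i)).comp tendsto_natCast_atTop_atTop
  refine le_antisymm (ge_of_tendsto hlo ?_) (le_of_tendsto hhi ?_)
  · filter_upwards [eventually_gt_atTop 0] with n hn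
    rw [← hgrid' n]
    refine measureReal_mono (Ici_subset_Ici.2 fun i => ?_)
    rw [div_le_iff₀ (Nat.cast_pos.2 hn)]
    exact Nat.floor_le (mul_nonneg (hy i) n.cast_nonneg)
  · filter_upwards [eventually_gt_atTop 0] with n hn
    rw [← hgrid' n]
    refine measureReal_mono (Ici_subset_Ici.2 fun i => ?_)
    rw [le_div_iff₀ (Nat.cast_pos.2 hn)]
    exact Nat.le_ceil _

end

/-! ### The survival function of a transformed Archimedean copula -/

theorem IsCopulaLaw.ae_mem_Ioo {ι : Type*} {ν : Measure (ι → ℝ)} (h : IsCopulaLaw ν) (i : ι) :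
    ∀ᵐ z ∂ν, z i ∈ Ioo (0 : ℝ) 1 := by
  have h1 : ∀ᵐ u ∂(ν.map fun z => z i), u ∈ Ioo (0 : ℝ) 1 := by
    rw [h.map_eval i]
    exact ae_restrict_mem measurableSet_Ioo
  exact ae_of_ae_map (measurable_pi_apply i).aemeasurable h1

/-- The copula formula read in the coordinates X_i = φ⁻¹(U_i), whose joint survival function depends
on the sum of the arguments only. -/
theorem IsArchimedeanCopulaLaw.measureReal_le_survivalInv {d : ℕ} {φ : ℝ → ℝ}
    {μ : Measure (Fin d → ℝ)} (hφ : IsSurvival φ) (hμ : IsArchimedeanCopulaLaw φ μ)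
    {x : Fin d → ℝ} (hx : 0 ≤ x) :
    μ.real {z | ∀ i, x i ≤ survivalInv φ (z i)} = φ (∑ i, x i) := by
  have hmem : ∀ᵐ z ∂μ, ∀ i, z i ∈ Ioo (0 : ℝ) 1 := ae_all_iff.2 hμ.isCopulaLaw.ae_mem_Ioo
  have h1 : μ.real {z | ∀ i, x i ≤ survivalInv φ (z i)} = μ.real (Iic fun i => φ (x i)) := by
    refine measureReal_congr (eventuallyEq_set.2 ?_)
    filter_upwards [hmem] with z hz
    exact forall_congr' fun i => hφ.le_survivalInv_iff (hz i) (hx i)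
  rw [h1]
  by_cases hpos : ∀ i, 0 < φ (x i)
  · rw [hμ.cdf_eq _ fun i => ⟨hpos i, hφ.le_one (hx i)⟩]
    simp_rw [fun i => hφ.generatorInv_apply (hx i) (hpos i)]
  -- Beyond the endpoint of φ the copula formula is not available, as it needs positive arguments;
  -- here both sides vanish because U_i > 0 almost surely.
  · push Not at hpos
    obtain ⟨i, hi⟩ := hpos
    have hsum : φ (∑ i, x i) = 0 := by
      have hle : x i ≤ ∑ i, x i := Finset.single_le_sum (fun j _ => hx j) (Finset.mem_univ i)
      have hi0 : 0 ≤ ∑ i, x i := (hx i).trans hle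
      exact le_antisymm ((hφ.antitoneOn (hx i) hi0 hle).trans hi) (hφ.nonneg _ hi0)
    rw [hsum, measureReal_eq_zero_iff (by
      have := hμ.isCopulaLaw.isProbabilityMeasure
      exact measure_ne_top _ _)]
    refine measure_eq_zero_iff_ae_notMem.2 ?_
    filter_upwards [hmem] with z hz hle
    exact absurd ((hz i).1.trans_le ((hle i).trans hi)) (lt_irrefl _)

/-! ### Independence by rescaling -/

/-- The two hypotheses make the law of the triple a full product measure, which may be bracketed the
other way. -/
theorem ProbabilityTheory.IndepFun.prodMk_of_prodMk {Ω α β γ : Type*} [MeasurableSpace Ω]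
    [MeasurableSpace α] [MeasurableSpace β] [MeasurableSpace γ] {P : Measure Ω}
    [IsProbabilityMeasure P] {V : Ω → α} {T : Ω → β} {Z : Ω → γ} (hV : Measurable V)
    (hT : Measurable T) (hZ : Measurable Z) (h : IndepFun V (fun ω => (T ω, Z ω)) P)
    (hTZ : IndepFun T Z P) : IndepFun (fun ω => (V ω, T ω)) Z P := by
  have hVT : IndepFun V T P := h.comp measurable_id measurable_fst
  have := Measure.isProbabilityMeasure_map (μ := P) hV.aemeasurable
  have := Measure.isProbabilityMeasure_map (μ := P) hT.aemeasurable
  have := Measure.isProbabilityMeasure_map (μ := P) hZ.aemeasurable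
  rw [indepFun_iff_map_prod_eq_prod_map_map (by fun_prop) (by fun_prop)] at h hTZ hVT ⊢
  rw [hVT]
  rw [hTZ] at h
  have h2 := congrArg (Measure.map MeasurableEquiv.prodAssoc.symm) h
  rw [Measure.map_map (MeasurableEquiv.measurable _) (by fun_prop)] at h2
  refine Eq.trans h2 ?_
  rw [← Measure.prodAssoc_prod, Measure.map_map (MeasurableEquiv.measurable _)
    (MeasurableEquiv.measurable _), MeasurableEquiv.symm_comp_self, Measure.map_id]

section

variable {ι Ω : Type*} [Fintype ι] [MeasurableSpace Ω] {P : Measure Ω} [IsProbabilityMeasure P]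
  {T : Ω → ℝ} {Y : Ω → ι → ℝ} {φ f ψ : ℝ → ℝ} {b : ℝ}

/-- Given T = t, the event z ≤ Y / (1 + bt) is Y ≥ (1 + bt) z. Its conditional probability f(t + (1
+ bt) Σ z_i) / f(t) equals ψ(Σ z_i), free of t; integrating over B gives a product. -/
theorem HasSurvivalDensity.measure_inter_rescaled (h : HasSurvivalDensity φ f)
    (hψ : ∀ t, 0 < t → 0 < f t → 0 < 1 + b * t ∧
      ∀ s, 0 ≤ s → f (t + s) = f t * ψ (s / (1 + b * t)))
    (hT : Measurable T) (hY : Measurable Y)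
    (hS : ∀ t y, 0 ≤ t → 0 ≤ y → P.real {ω | t ≤ T ω ∧ y ≤ Y ω} = φ (t + ∑ i, y i)) :
    (∀ᵐ ω ∂P, 0 < 1 + b * T ω) ∧ ∀ B, MeasurableSet B → ∀ z : ι → ℝ, 0 ≤ z →
      P (T ⁻¹' B ∩ {ω | z ≤ fun i => Y ω i / (1 + b * T ω)}) =
        P (T ⁻¹' B) * ENNReal.ofReal (ψ (∑ i, z i)) := by
  have hκ := h.condDistrib_Ici hT hY hS
  have hpos : ∀ᵐ t ∂(P.map T), 0 < 1 + b * t := by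
    filter_upwards [hκ] with t ht
    exact (hψ t ht.1 ht.2.1).1
  have hpos' : ∀ᵐ ω ∂P, 0 < 1 + b * T ω := ae_of_ae_map hT.aemeasurable hpos
  refine ⟨hpos', fun B hB z hz => ?_⟩
  set E : Set (ℝ × (ι → ℝ)) :=
    Prod.fst ⁻¹' B ∩ ⋂ i, {p | (1 + b * p.1) * z i ≤ p.2 i} with hE
  have hEm : MeasurableSet E := by
    refine (measurable_fst hB).inter ?_
    exact MeasurableSet.iInter fun i => measurableSet_le (by fun_prop) (by fun_prop)
  have h1 : P (T ⁻¹' B ∩ {ω | z ≤ fun i => Y ω i / (1 + b * T ω)}) =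
      P.map (fun ω => (T ω, Y ω)) E := by
    rw [Measure.map_apply (hT.prodMk hY) hEm]
    refine measure_congr (eventuallyEq_set.2 ?_)
    filter_upwards [hpos'] with ω hω
    refine and_congr Iff.rfl (Iff.trans (forall_congr' fun i => ?_) mem_iInter.symm)
    change z i ≤ Y ω i / (1 + b * T ω) ↔ (1 + b * T ω) * z i ≤ Y ω i
    rw [le_div_iff₀ hω, mul_comm]
  rw [h1, ← compProd_map_condDistrib hY.aemeasurable, Measure.compProd_apply hEm,
    ← Measure.map_apply hT hB]
  have h2 : ∀ᵐ t ∂(P.map T), condDistrib Y T P t (Prod.mk t ⁻¹' E) =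
      B.indicator (fun _ => ENNReal.ofReal (ψ (∑ i, z i))) t := by
    filter_upwards [hκ] with t ht
    obtain ⟨h3, h4⟩ := hψ t ht.1 ht.2.1
    by_cases htB : t ∈ B
    · have h5 : Prod.mk t ⁻¹' E = Ici fun i => (1 + b * t) * z i := by
        ext y
        simp [hE, htB, Pi.le_def]
      have h6 : (0 : ι → ℝ) ≤ fun i => (1 + b * t) * z i := fun i => mul_nonneg h3.le (hz i)
      rw [h5, indicator_of_mem htB, ← ofReal_measureReal, ht.2.2 _ h6, ← Finset.mul_sum,
        h4 _ (mul_nonneg h3.le (Finset.sum_nonneg fun i _ => hz i)),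
        mul_div_cancel_left₀ _ h3.ne', mul_div_cancel_left₀ _ ht.2.1.ne']
    · have h5 : Prod.mk t ⁻¹' E = ∅ := by
        ext y
        simp [hE, htB]
      rw [h5, indicator_of_notMem htB, measure_empty]
  rw [lintegral_congr_ae h2, lintegral_indicator_const hB, mul_comm]

/-- If the conditional survival functions of `Y` given `T = t` differ only by the factor
`1 + b t` in the argument, then dividing by this factor makes `Y` independent of `T`. -/
theorem HasSurvivalDensity.indepFun_rescaled (h : HasSurvivalDensity φ f)
    (hψ : ∀ t, 0 < t → 0 < f t → 0 < 1 + b * t ∧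
      ∀ s, 0 ≤ s → f (t + s) = f t * ψ (s / (1 + b * t)))
    (hT : Measurable T) (hY : Measurable Y)
    (hS : ∀ t y, 0 ≤ t → 0 ≤ y → P.real {ω | t ≤ T ω ∧ y ≤ Y ω} = φ (t + ∑ i, y i)) :
    IndepFun T (fun ω i => Y ω i / (1 + b * T ω)) P := by
  obtain ⟨hpos, key⟩ := h.measure_inter_rescaled hψ hT hY hS
  set Z : Ω → ι → ℝ := fun ω i => Y ω i / (1 + b * T ω) with hZ
  have hZm : Measurable Z := by fun_prop
  have hZ0 : ∀ᵐ ω ∂P, 0 ≤ Z ω := by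
    have h1 : P.real {ω | 0 ≤ T ω ∧ (0 : ι → ℝ) ≤ Y ω} = 1 := by
      rw [hS 0 0 le_rfl le_rfl]
      simp [h.map_zero]
    filter_upwards [hpos, ae_of_measureReal_eq_one
      ((hT measurableSet_Ici).inter (hY (measurableSet_Ici_pi 0))) h1] with ω hω hω' i
    exact div_nonneg (hω'.2 i) hω.le
  -- The π-system argument needs thresholds of any sign; negative ones may be raised to 0 because Z
  -- ≥ 0 almost surely.
  have key' : ∀ B, MeasurableSet B → ∀ z : ι → ℝ, P (T ⁻¹' B ∩ Z ⁻¹' Ici z) =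
      P (T ⁻¹' B) * ENNReal.ofReal (ψ (∑ i, max (z i) 0)) := by
    intro B hB z
    rw [← key B hB (fun i => max (z i) 0) fun i => le_max_right _ _]
    refine measure_congr (eventuallyEq_set.2 ?_)
    filter_upwards [hZ0] with ω hω
    refine and_congr Iff.rfl (forall_congr' fun i => ?_)
    exact ⟨fun hle => max_le hle (hω i), fun hle => (le_max_left _ _).trans hle⟩
  rw [indepFun_iff_measure_inter_preimage_eq_mul]
  intro B C hB hC
  have h1 : (P.restrict (T ⁻¹' B)).map Z = P (T ⁻¹' B) • P.map Z := by
    refine Measure.ext_of_Ici_pi ?_ fun z => ?_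
    · rw [Measure.smul_apply, Measure.map_apply hZm .univ, Measure.map_apply hZm .univ]
      simp
    · rw [Measure.smul_apply, Measure.map_apply hZm (measurableSet_Ici_pi z),
        Measure.map_apply hZm (measurableSet_Ici_pi z),
        Measure.restrict_apply (hZm (measurableSet_Ici_pi z)), inter_comm, key' B hB z]
      have := key' univ .univ z
      rw [preimage_univ, univ_inter, measure_univ, one_mul] at this
      rw [this, smul_eq_mul]
  have h2 := congrArg (fun m => m C) h1
  simp only [Measure.smul_apply, smul_eq_mul] at h2
  rw [Measure.map_apply hZm hC, Measure.map_apply hZm hC, Measure.restrict_apply (hZm hC)] at h2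
  rw [inter_comm, h2]

end

/-! ### Conditioning on several coordinates by rescaling -/

section

variable {κ Ω : Type*} [DecidableEq κ] [MeasurableSpace Ω]

/-- The coordinates in `D`; the others are replaced by `0`. -/
def maskedCoords (X : Ω → κ → ℝ) (D : Finset κ) (ω : Ω) (i : κ) : ℝ :=
  if i ∈ D then X ω i else 0

/-- The coordinates outside `D`, divided by `1 + b ∑_{j ∈ D} X_j`. -/
noncomputable def rescaledCoords (b : ℝ) (X : Ω → κ → ℝ) (D : Finset κ) (ω : Ω) (i : κ) : ℝ :=
  if i ∈ D then 0 else X ω i / (1 + b * ∑ j ∈ D, X ω j)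

theorem measurable_maskedCoords {X : Ω → κ → ℝ} (hX : Measurable X) (D : Finset κ) :
    Measurable (maskedCoords X D) := by
  refine measurable_pi_lambda _ fun i => ?_
  by_cases hi : i ∈ D
  · simp only [maskedCoords, hi, if_true]
    fun_prop
  · simp [maskedCoords, hi]

theorem measurable_rescaledCoords {X : Ω → κ → ℝ} (hX : Measurable X) (b : ℝ) (D : Finset κ) :
    Measurable (rescaledCoords b X D) := by
  refine measurable_pi_lambda _ fun i => ?_
  by_cases hi : i ∈ D
  · simp [rescaledCoords, hi]
  · simp only [rescaledCoords, hi, if_false]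
    fun_prop

variable [Fintype κ] {P : Measure Ω} [IsProbabilityMeasure P] {X : Ω → κ → ℝ} {ψ f : ℕ → ℝ → ℝ} {b : ℝ}

/-- Induction on D, where ψ k is the generator of the rescaled remaining coordinates after k of them
have been conditioned on. Adding m to D applies the one-variable result to T, the rescaled
coordinate m, and Y, the rescaled coordinates outside the enlarged set. -/
theorem indepFun_rescaledCoords (hX : Measurable X)
    (hS : ∀ x, 0 ≤ x → P.real {ω | x ≤ X ω} = ψ 0 (∑ i, x i)) (D : Finset κ)
    (hnonneg : ∀ k ≤ D.card, ∀ s, 0 ≤ s → 0 ≤ ψ k s)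
    (hdens : ∀ k < D.card, HasSurvivalDensity (ψ k) (f k))
    (hψ : ∀ k < D.card, ∀ t, 0 < t → 0 < f k t → 0 < 1 + b * t ∧
      ∀ s, 0 ≤ s → f k (t + s) = f k t * ψ (k + 1) (s / (1 + b * t))) :
    (∀ᵐ ω ∂P, 0 < 1 + b * ∑ j ∈ D, X ω j) ∧
    (∀ x : κ → ℝ, 0 ≤ x → (∀ i ∈ D, x i = 0) →
      P.real {ω | x ≤ rescaledCoords b X D ω} = ψ D.card (∑ i, x i)) ∧
    IndepFun (maskedCoords X D) (rescaledCoords b X D) P := by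
  induction D using Finset.induction_on with
  | empty =>
    refine ⟨by simp, fun x hx _ => ?_, ?_⟩
    · have : rescaledCoords b X ∅ = X := by
        ext
        simp [rescaledCoords]
      rw [Finset.card_empty, ← hS x hx, this]
    · have : maskedCoords X ∅ = fun _ _ => 0 := by
        ext
        simp [maskedCoords]
      rw [this]
      exact indepFun_const_left _ _
  | insert m D hm ih =>
    rw [Finset.card_insert_of_notMem hm] at hnonneg hdens hψ ⊢
    obtain ⟨hpos, hW, hind⟩ := ih (fun k hk => hnonneg k (by omega))
      (fun k hk => hdens k (by omega)) fun k hk => hψ k (by omega)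
    set D' := insert m D with hD'
    have hmD' : m ∈ D' := Finset.mem_insert_self m D
    have hWm := measurable_rescaledCoords hX b D
    set W := rescaledCoords b X D with hWdef
    set T : Ω → ℝ := fun ω => W ω m with hTdef
    set Y : Ω → {i // i ∉ D'} → ℝ := fun ω i => W ω i with hYdef
    have hT : Measurable T := by fun_prop
    have hY : Measurable Y := by fun_prop
    -- extension of a threshold for `T` and thresholds for `Y` to all coordinates
    let ext : ℝ → ({i // i ∉ D'} → ℝ) → κ → ℝ := fun t y i =>
      if h : i ∈ D' then (if i = m then t else 0) else y ⟨i, h⟩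
    have ext_sum : ∀ t y, ∑ i, ext t y i = t + ∑ i, y i := by
      intro t y
      rw [← Finset.sum_add_sum_compl D']
      congr 1
      · rw [Finset.sum_congr rfl (g := fun i => if i = m then t else 0)]
        · simp [hmD']
        · intro i hi
          simp [ext, hi]
      · rw [Finset.sum_subtype D'ᶜ (p := fun i => i ∉ D') (by simp)]
        refine Finset.sum_congr rfl fun i _ => ?_
        simp [ext, i.2]
    have hSY : ∀ t y, 0 ≤ t → 0 ≤ y → P.real {ω | t ≤ T ω ∧ y ≤ Y ω} =
        ψ D.card (t + ∑ i, y i) := by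
      intro t y ht hy
      rw [← ext_sum, ← hW]
      · congr 1
        ext ω
        constructor
        · rintro ⟨h1, h2⟩ i
          by_cases hi : i ∈ D'
          · by_cases him : i = m
            · subst him
              simpa [ext, hmD'] using h1
            · have : i ∈ D := (Finset.mem_insert.1 hi).resolve_left him
              simp [ext, hi, him, hWdef, rescaledCoords, this]
          · simpa [ext, hi] using h2 ⟨i, hi⟩
        · intro h1
          refine ⟨by simpa [ext, hmD'] using h1 m, fun i => ?_⟩
          simpa [ext, i.2] using h1 i
      · intro i
        by_cases hi : i ∈ D'
        · by_cases him : i = m <;> simp [ext, hi, him, hmD', ht]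
        · simpa [ext, hi] using hy ⟨i, hi⟩
      · intro i hi
        have h1 : i ∈ D' := Finset.mem_insert_of_mem hi
        have h2 : i ≠ m := fun h => hm (h ▸ hi)
        simp [ext, h1, h2]
    have hd := hdens D.card (by omega)
    have hstep := hψ D.card (by omega)
    obtain ⟨hTpos, hTZ⟩ := hd.measure_inter_rescaled hstep hT hY hSY
    have hTZind := hd.indepFun_rescaled hstep hT hY hSY
    set Z : Ω → {i // i ∉ D'} → ℝ := fun ω i => Y ω i / (1 + b * T ω) with hZdef
    have hZ : Measurable Z := by fun_prop
    -- The scale factors multiply: since T = X_m / (1 + b Σ_D X), rescaling by the D-factor and then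
    -- by 1 + bT is rescaling by the factor of D ∪ {m}.
    have hfac : ∀ᵐ ω ∂P, 1 + b * ∑ j ∈ D', X ω j =
        (1 + b * ∑ j ∈ D, X ω j) * (1 + b * T ω) := by
      filter_upwards [hpos] with ω hω
      simp only [hTdef, hWdef, rescaledCoords, hm, if_false]
      rw [hD', Finset.sum_insert hm]
      field_simp
      ring
    have hresc : ∀ᵐ ω ∂P, ∀ i, rescaledCoords b X D' ω i =
        if h : i ∈ D' then 0 else Z ω ⟨i, h⟩ := by
      filter_upwards [hfac] with ω hω i
      by_cases hi : i ∈ D'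
      · simp [rescaledCoords, hi]
      · have : i ∉ D := fun h => hi (Finset.mem_insert_of_mem h)
        simp only [rescaledCoords, hi, if_false, dif_neg, not_false_iff, hZdef, hYdef, hWdef, this,
          hω, div_div]
    refine ⟨?_, fun x hx hx0 => ?_, ?_⟩
    · filter_upwards [hpos, hTpos, hfac] with ω h1 h2 h3
      rw [h3]
      exact mul_pos h1 h2
    · have h1 := hTZ univ .univ (fun i => x i) fun i => hx i
      rw [preimage_univ, univ_inter, measure_univ, one_mul] at h1
      have h2 : ∑ i : {i // i ∉ D'}, x i = ∑ i, x i := by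
        rw [← Finset.sum_add_sum_compl D', Finset.sum_eq_zero hx0, zero_add,
          Finset.sum_subtype D'ᶜ (p := fun i => i ∉ D') (by simp)]
      have h3 : {ω | x ≤ rescaledCoords b X D' ω} =ᵐ[P]
          {ω | (fun i : {i // i ∉ D'} => x i) ≤ Z ω} := by
        refine eventuallyEq_set.2 ?_
        filter_upwards [hresc] with ω hω
        constructor
        · intro h i
          have := h i
          rw [hω, dif_neg i.2] at this
          exact this
        · intro h i
          rw [hω]
          by_cases hi : i ∈ D'
          · simp [hi, hx0 i hi]
          · rw [dif_neg hi]
            exact h ⟨i, hi⟩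
      rw [measureReal_congr h3, measureReal_def, h1, h2, ENNReal.toReal_ofReal]
      exact hnonneg _ le_rfl _ (Finset.sum_nonneg fun i _ => hx i)
    · have h1 : IndepFun (fun ω => (maskedCoords X D ω, T ω)) Z P := by
        refine IndepFun.prodMk_of_prodMk (measurable_maskedCoords hX D) hT hZ ?_ hTZind
        exact hind.comp (ψ := fun w => (w m, fun i : {i // i ∉ D'} => w i / (1 + b * w m)))
          measurable_id (by fun_prop)
      -- X_m is recovered as T (1 + b Σ_D X), so the coordinates in D ∪ {m} are a function of those
      -- in D and T.
      have h2 := h1.comp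
        (φ := fun p i => if i = m then p.2 * (1 + b * ∑ j ∈ D, p.1 j) else p.1 i)
        (ψ := fun z i => if h : i ∈ D' then 0 else z ⟨i, h⟩) (by
          refine measurable_pi_lambda _ fun i => ?_
          by_cases hi : i = m <;> simp only [hi, if_true, if_false] <;> fun_prop) (by
          refine measurable_pi_lambda _ fun i => ?_
          by_cases hi : i ∈ D' <;> simp only [hi, dite_true, dite_false] <;> fun_prop)
      refine h2.congr ?_ ?_
      · filter_upwards [hpos] with ω hω
        ext i
        by_cases hi : i = m
        · subst hi
          have : ∑ j ∈ D, maskedCoords X D ω j = ∑ j ∈ D, X ω j :=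
            Finset.sum_congr rfl fun j hj => by simp [maskedCoords, hj]
          have h3 : T ω = X ω i / (1 + b * ∑ j ∈ D, X ω j) := by
            simp [hTdef, hWdef, rescaledCoords, hm]
          simp only [Function.comp_apply, if_true, this, h3]
          rw [maskedCoords, if_pos hmD', div_mul_cancel₀ _ hω.ne']
        · have : i ∈ D' ↔ i ∈ D := by simp [hD', hi]
          simp [maskedCoords, hi, this]
      · filter_upwards [hresc] with ω hω
        ext i
        exact (hω i).symm

end

/-! ### Copulas of monotone transforms -/

theorem volume_restrict_Ioo_Iic (u : ℝ) :
    (volume.restrict (Ioo (0 : ℝ) 1)) (Iic u) = ENNReal.ofReal (min 1 u) := by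
  rw [restrict_Ioo_eq_restrict_Ioc, Measure.restrict_apply measurableSet_Iic, inter_comm,
    Ioc_inter_Iic, Real.volume_Ioc, sub_zero]

/-- The probability integral transform for survival functions. -/
theorem IsSurvival.map_eq_uniform {Ω : Type*} [MeasurableSpace Ω] {P : Measure Ω}
    [IsProbabilityMeasure P] {ψ : ℝ → ℝ} (hψ : IsSurvival ψ) {W : Ω → ℝ} (hW : Measurable W)
    (hS : ∀ w, 0 ≤ w → P.real {ω | w ≤ W ω} = ψ w) :
    P.map (fun ω => ψ (max (W ω) 0)) = volume.restrict (Ioo 0 1) := by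
  have hm : Measurable fun ω => ψ (max (W ω) 0) := hψ.continuous_comp_max.measurable.comp hW
  have hW0 : ∀ᵐ ω ∂P, 0 ≤ W ω :=
    ae_of_measureReal_eq_one (hW measurableSet_Ici) (by rw [hS 0 le_rfl, hψ.map_zero])
  have key : ∀ u, 0 < u → u ≤ 1 → P {ω | ψ (max (W ω) 0) ≤ u} = ENNReal.ofReal u := by
    intro u hu0 hu1
    obtain ⟨w, hw, rfl⟩ := hψ.exists_eq ⟨hu0, hu1⟩
    suffices h : P {ω | ψ (max (W ω) 0) ≤ ψ w} = P {ω | w ≤ W ω} by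
      rw [h, ← hS w hw, ofReal_measureReal]
    refine measure_congr (eventuallyEq_set.2 ?_)
    filter_upwards [hW0] with ω hω
    rw [max_eq_left hω]
    refine ⟨fun hle => ?_, fun hle => hψ.antitoneOn hw hω hle⟩
    by_contra! hlt
    exact absurd hle (hψ.lt_of_lt _ _ hω hlt
      (hu0.trans_le (hψ.antitoneOn hω hw hlt.le))).not_ge
  refine Measure.ext_of_Iic _ _ fun u => ?_
  rw [volume_restrict_Ioo_Iic, Measure.map_apply hm measurableSet_Iic]
  rcases le_or_gt u 0 with hu | hu
  · rw [ENNReal.ofReal_of_nonpos ((min_le_right _ _).trans hu)]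
    -- For u ≤ 0 the event lies in the events with level r, for arbitrarily small r > 0, which have
    -- probability r.
    refine le_antisymm (le_of_forall_gt_imp_ge_of_dense fun ε hε => ?_) zero_le
    obtain ⟨r, hr0, hr1, hrε⟩ : ∃ r : ℝ, 0 < r ∧ r ≤ 1 ∧ ENNReal.ofReal r ≤ ε := by
      by_cases h1 : 1 ≤ ε
      · exact ⟨1, one_pos, le_rfl, by simpa using h1⟩
      · push Not at h1
        have htop : ε ≠ ⊤ := (h1.trans ENNReal.one_lt_top).ne
        refine ⟨ε.toReal, ENNReal.toReal_pos hε.ne' htop, ?_, ENNReal.ofReal_toReal_le⟩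
        simpa using ENNReal.toReal_mono ENNReal.one_ne_top h1.le
    rw [← key r hr0 hr1] at hrε
    exact (measure_mono fun ω (hω : ψ (max (W ω) 0) ≤ u) => hω.trans (hu.trans hr0.le)).trans hrε
  · rcases le_or_gt u 1 with hu1 | hu1
    · rw [min_eq_right hu1]
      exact key u hu hu1
    · have : (fun ω => ψ (max (W ω) 0)) ⁻¹' Iic u = univ :=
        eq_univ_of_forall fun ω => (hψ.le_one (le_max_right _ _)).trans hu1.le
      rw [this, measure_univ, min_eq_left hu1.le, ENNReal.ofReal_one]

/-- Initial segments of `(0, 1)` are determined by their length. -/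
theorem ae_mem_iff_le_of_monotoneOn {g : ℝ → ℝ} (hg : MonotoneOn g (Ioo 0 1)) (y : ℝ) :
    ∀ᵐ w ∂(volume.restrict (Ioo (0 : ℝ) 1)),
      g w ≤ y ↔ w ≤ (volume.restrict (Ioo (0 : ℝ) 1)).real {w | g w ≤ y} := by
  set c := (volume.restrict (Ioo (0 : ℝ) 1)).real {w | g w ≤ y} with hc
  -- The cut point c is the only place where the two conditions can differ, according to whether the
  -- initial segment is open or closed.
  have hne : ∀ᵐ w ∂(volume.restrict (Ioo (0 : ℝ) 1)), w ≠ c :=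
    ae_restrict_of_ae (Measure.ae_ne volume c)
  have hIic : ∀ w ∈ Ioo (0 : ℝ) 1, (volume.restrict (Ioo (0 : ℝ) 1)).real (Iic w) = w := by
    intro w hw
    rw [measureReal_def, volume_restrict_Ioo_Iic, min_eq_right hw.2.le,
      ENNReal.toReal_ofReal hw.1.le]
  filter_upwards [hne, ae_restrict_mem measurableSet_Ioo] with w hwc hw
  constructor
  · intro hwy
    rw [← hIic w hw]
    refine ENNReal.toReal_mono (measure_ne_top _ _) (measure_mono_ae ?_)
    filter_upwards [ae_restrict_mem measurableSet_Ioo] with v hv hvw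
    exact (hg hv hw hvw).trans hwy
  · intro hwc'
    by_contra! hwy
    refine hwc (le_antisymm hwc' ?_)
    rw [← hIic w hw]
    refine ENNReal.toReal_mono (measure_ne_top _ _) (measure_mono_ae ?_)
    filter_upwards [ae_restrict_mem measurableSet_Ioo] with v hv hvy
    by_contra hvw
    exact absurd ((hg hw hv (not_le.1 hvw).le).trans hvy) hwy.not_ge

/-- Up to a null set, g_i(z_i) ≤ y_i says that z_i lies in an initial segment of (0, 1) whose length
is the marginal probability. Neither strictness nor continuity of g_i is needed. -/
theorem IsCopulaLaw.couples_map {ι : Type*} [Fintype ι] {ν : Measure (ι → ℝ)} (hν : IsCopulaLaw ν)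
    {g : ι → ℝ → ℝ} (hgm : ∀ i, Measurable (g i)) (hg : ∀ i, MonotoneOn (g i) (Ioo 0 1)) :
    Couples (fun u => ν.real (Iic u)) (ν.map fun z i => g i (z i)) := by
  intro y
  have hG : Measurable fun (z : ι → ℝ) i => g i (z i) :=
    measurable_pi_lambda _ fun i => (hgm i).comp (measurable_pi_apply i)
  have h1 : ∀ i, (ν.map fun z i => g i (z i)).real {z | z i ≤ y i} =
      (volume.restrict (Ioo (0 : ℝ) 1)).real {w | g i w ≤ y i} := by
    intro i
    have h2 : MeasurableSet {z : ι → ℝ | z i ≤ y i} := measurable_pi_apply i measurableSet_Iic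
    rw [map_measureReal_apply hG h2, ← hν.map_eval i,
      map_measureReal_apply (measurable_pi_apply i) (hgm i measurableSet_Iic)]
    rfl
  simp only [h1]
  rw [map_measureReal_apply hG isClosed_Iic.measurableSet]
  refine measureReal_congr (eventuallyEq_set.2 ?_)
  have h2 : ∀ᵐ z ∂ν, ∀ i, g i (z i) ≤ y i ↔
      z i ≤ (volume.restrict (Ioo (0 : ℝ) 1)).real {w | g i w ≤ y i} := by
    rw [ae_all_iff]
    intro i
    have := ae_mem_iff_le_of_monotoneOn (hg i) (y i)
    rw [← hν.map_eval i] at this ⊢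
    exact ae_of_ae_map (measurable_pi_apply i).aemeasurable this
  filter_upwards [h2] with z hz
  exact forall_congr' hz

/-- Conditioning on V freezes it in h(V, W) and leaves the law of the independent W unchanged. -/
theorem condDistrib_of_indepFun_comp {Ω α β γ : Type*} [MeasurableSpace Ω] [MeasurableSpace α]
    [MeasurableSpace β] [MeasurableSpace γ] [StandardBorelSpace γ] [Nonempty γ] {P : Measure Ω}
    [IsProbabilityMeasure P] {V : Ω → α} {W : Ω → β} {Y : Ω → γ} (hV : Measurable V)
    (hW : Measurable W) (hind : IndepFun V W P) {h : α × β → γ} (hh : Measurable h)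
    (hY : Y =ᵐ[P] fun ω => h (V ω, W ω)) :
    ∀ᵐ v ∂(P.map V), condDistrib Y V P v = (P.map W).map fun w => h (v, w) := by
  have := Measure.isProbabilityMeasure_map (μ := P) hV.aemeasurable
  have := Measure.isProbabilityMeasure_map (μ := P) hW.aemeasurable
  have hYm : AEMeasurable Y P := (hh.comp (hV.prodMk hW)).aemeasurable.congr hY.symm
  let κ : Kernel α γ := (Kernel.id ×ₖ Kernel.const α (P.map W)).map h
  have hκ : ∀ v, κ v = (P.map W).map fun w => h (v, w) := by
    intro v
    rw [Kernel.map_apply _ hh, Kernel.prod_apply, Kernel.id_apply, Kernel.const_apply,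
      Measure.dirac_prod, Measure.map_map hh (by fun_prop)]
    rfl
  have : IsFiniteKernel κ := by
    have : IsMarkovKernel κ := Kernel.IsMarkovKernel.map _ hh
    infer_instance
  have key := condDistrib_ae_eq_of_measure_eq_compProd (μ := P) V hYm (κ := κ) (by
    rw [Measure.map_congr (g := fun ω => (V ω, h (V ω, W ω)))
      (hY.mono fun ω hω => by simp only [hω])]
    ext s hs
    have hs' : MeasurableSet ((fun p : α × β => (p.1, h p)) ⁻¹' s) :=
      (measurable_fst.prodMk hh) hs
    rw [Measure.compProd_apply hs, Measure.map_apply (by fun_prop) hs]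
    have h1 : ∀ v, κ v (Prod.mk v ⁻¹' s) =
        P.map W (Prod.mk v ⁻¹' ((fun p : α × β => (p.1, h p)) ⁻¹' s)) := by
      intro v
      rw [hκ, Measure.map_apply (by fun_prop) (measurable_prodMk_left hs)]
      rfl
    simp_rw [h1]
    rw [← Measure.prod_apply hs', ← hind.map_prod_eq_prod_map_map hV.aemeasurable hW.aemeasurable,
      Measure.map_apply (hV.prodMk hW) hs']
    rfl)
  filter_upwards [key] with v hv
  rw [hv, hκ]

/-- With R the rescaled coordinates, W_i = ψ_{|D|}(R_i) is uniform, W is independent of U_D, and U_i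
= φ((1 + b Σ_D X) ψ_{|D|}⁻¹(W_i)). For a fixed value of U_D this is increasing in W_i, so the
conditional copula is the distribution function of W. -/
theorem IsArchimedeanCopulaLaw.conditionalCopulaConstant {d : ℕ} {φ : ℝ → ℝ}
    {μ : Measure (Fin d → ℝ)} [IsProbabilityMeasure μ] (hφ : IsSurvival φ)
    (hμ : IsArchimedeanCopulaLaw φ μ) {A D : Finset (Fin d)} (hAD : Disjoint A D)
    {ψ f : ℕ → ℝ → ℝ} {b : ℝ} (hψ0 : ∀ s, 0 ≤ s → ψ 0 s = φ s)
    (hnonneg : ∀ k ≤ D.card, ∀ s, 0 ≤ s → 0 ≤ ψ k s)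
    (hsurv : IsSurvival (ψ D.card))
    (hdens : ∀ k < D.card, HasSurvivalDensity (ψ k) (f k))
    (hψ : ∀ k < D.card, ∀ t, 0 < t → 0 < f k t → 0 < 1 + b * t ∧
      ∀ s, 0 ≤ s → f k (t + s) = f k t * ψ (k + 1) (s / (1 + b * t))) :
    ConditionalCopulaConstant μ A D := by
  let X : (Fin d → ℝ) → Fin d → ℝ := fun z i => survivalInv φ (z i)
  have hX : Measurable X :=
    measurable_pi_lambda _ fun i => hφ.measurable_survivalInv.comp (measurable_pi_apply i)
  have hX0 : ∀ z i, 0 ≤ X z i := fun z i => IsSurvival.survivalInv_nonneg φ _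
  have hmem : ∀ᵐ z ∂μ, ∀ i, z i ∈ Ioo (0 : ℝ) 1 := ae_all_iff.2 hμ.isCopulaLaw.ae_mem_Ioo
  obtain ⟨hpos, hW, hind⟩ := indepFun_rescaledCoords (P := μ) (X := X) (ψ := ψ) (b := b) hX
    (fun x hx => by
      rw [hψ0 _ (Finset.sum_nonneg fun i _ => hx i), ← hμ.measureReal_le_survivalInv hφ hx]
      rfl) D hnonneg hdens hψ
  set R := rescaledCoords b X D with hR
  have hRm : Measurable R := measurable_rescaledCoords hX b D
  have hRi : ∀ i, Measurable fun z => R z i := fun i => (measurable_pi_apply i).comp hRm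
  have hR0 : ∀ᵐ z ∂μ, ∀ i, 0 ≤ R z i := by
    filter_upwards [hpos] with z hz i
    by_cases hi : i ∈ D
    · simp [hR, rescaledCoords, hi]
    · simpa [hR, rescaledCoords, hi] using div_nonneg (hX0 z i) hz.le
  let W : (Fin d → ℝ) → A → ℝ := fun z i => ψ D.card (max (R z i) 0)
  have hWm : Measurable W := measurable_pi_lambda _ fun i =>
    hsurv.continuous_comp_max.measurable.comp (hRi _)
  have hWu : ∀ i, μ.map (fun z => W z i) = volume.restrict (Ioo 0 1) := by
    intro i
    have hiD : i.1 ∉ D := Finset.disjoint_left.1 hAD i.2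
    refine hsurv.map_eq_uniform (W := fun z => R z i) (hRi _) ?_
    intro w hw
    -- Thresholds 0 at the other coordinates impose nothing, so the joint survival function returns
    -- the margin.
    have := hW (Pi.single i.1 w) (Pi.single_nonneg.2 hw) fun j hj => by
      have hne : j ≠ i.1 := fun h => hiD (h ▸ hj)
      simp [hne]
    rw [Finset.sum_pi_single', if_pos (Finset.mem_univ _)] at this
    rw [← this]
    refine measureReal_congr (eventuallyEq_set.2 ?_)
    filter_upwards [hR0] with z hz
    refine ⟨fun hle j => ?_, fun hle => by simpa using hle i.1⟩
    by_cases hj : j = i.1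
    · subst hj
      simpa using hle
    · rw [Pi.single_eq_of_ne hj]
      exact hz j
  have hν : IsCopulaLaw (μ.map W) := by
    refine ⟨Measure.isProbabilityMeasure_map hWm.aemeasurable, fun i => ?_⟩
    rw [Measure.map_map (measurable_pi_apply i) hWm]
    exact hWu i
  have hWmem : ∀ᵐ z ∂μ, ∀ i, W z i ∈ Ioo (0 : ℝ) 1 :=
    ae_of_ae_map hWm.aemeasurable (ae_all_iff.2 hν.ae_mem_Ioo)
  let V : (Fin d → ℝ) → D → ℝ := fun z => D.restrict z
  have hVm : Measurable V := D.measurable_restrict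
  have hVW : IndepFun V W μ := by
    have h1 := hind.comp
      (φ := fun (x : Fin d → ℝ) (j : D) => φ (max (x j) 0))
      (ψ := fun (r : Fin d → ℝ) (i : A) => ψ D.card (max (r i) 0))
      (measurable_pi_lambda _ fun j =>
        hφ.continuous_comp_max.measurable.comp (measurable_pi_apply _))
      (measurable_pi_lambda _ fun j =>
        hsurv.continuous_comp_max.measurable.comp (measurable_pi_apply _))
    refine h1.congr ?_ (ae_eq_refl _)
    filter_upwards [hmem] with z hz
    ext j
    simp only [Function.comp_apply, maskedCoords, j.2, if_true, X, V, Finset.restrict]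
    rw [max_eq_left (IsSurvival.survivalInv_nonneg φ _), hφ.apply_survivalInv (hz j)]
  let h : (D → ℝ) × (A → ℝ) → A → ℝ := fun p i =>
    φ (max ((1 + b * ∑ j, survivalInv φ (p.1 j)) * survivalInv (ψ D.card) (p.2 i)) 0)
  have hh : Measurable h := by
    have h1 := hφ.measurable_survivalInv
    have h2 := hsurv.measurable_survivalInv
    exact measurable_pi_lambda _ fun i => hφ.continuous_comp_max.measurable.comp (by fun_prop)
  have hsum : ∀ z, ∑ j, survivalInv φ (V z j) = ∑ j ∈ D, X z j := fun z =>
    Finset.sum_coe_sort D (X z)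
  have hY : (fun z : Fin d → ℝ => A.restrict z) =ᵐ[μ] fun z => h (V z, W z) := by
    filter_upwards [hmem, hpos, hR0, hWmem] with z hz hz1 hz2 hz3
    ext i
    have hiD : i.1 ∉ D := Finset.disjoint_left.1 hAD i.2
    simp only [h, W, hsum]
    rw [hsurv.survivalInv_apply (le_max_right _ _) (hz3 i), max_eq_left (hz2 i)]
    have : R z i = X z i / (1 + b * ∑ j ∈ D, X z j) := by simp [hR, rescaledCoords, hiD]
    rw [this, mul_div_cancel₀ _ hz1.ne', max_eq_left (hX0 z i)]
    exact (hφ.apply_survivalInv (hz i)).symm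
  have hposV : ∀ᵐ v ∂(μ.map V), 0 < 1 + b * ∑ j, survivalInv φ (v j) := by
    rw [ae_map_iff hVm.aemeasurable]
    · filter_upwards [hpos] with z hz
      rwa [hsum]
    · have h1 := hφ.measurable_survivalInv
      exact measurableSet_lt measurable_const (by fun_prop)
  refine ⟨fun u => (μ.map W).real (Iic u), ⟨μ.map W, hν, fun u => rfl⟩, ?_⟩
  filter_upwards [condDistrib_of_indepFun_comp hVm hWm hVW hh hY, hposV] with v hv hv0
  rw [hv]
  refine hν.couples_map (g := fun _ w =>
    φ (max ((1 + b * ∑ j, survivalInv φ (v j)) * survivalInv (ψ D.card) w) 0)) (fun i => ?_)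
    fun i w hw w' hw' hww' => ?_
  · have h2 := hsurv.measurable_survivalInv
    exact hφ.continuous_comp_max.measurable.comp (by fun_prop)
  · refine hφ.antitoneOn (mem_Ici.2 (le_max_right _ _)) (mem_Ici.2 (le_max_right _ _)) ?_
    exact max_le_max (mul_le_mul_of_nonneg_left (hsurv.antitoneOn_survivalInv hw hw' hww') hv0.le)
      le_rfl

/-! ### The generalized Clayton family -/

/-- The function `(1 + b s)_+ ^ p`. -/
noncomputable def claytonPow (b p s : ℝ) : ℝ := (max 0 (1 + b * s)) ^ p

/-- The condition 1 < p makes the right derivative at the kink 0, matching the left one. -/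
theorem hasDerivAt_max_zero_rpow {p : ℝ} (hp : 1 < p) (x : ℝ) :
    HasDerivAt (fun x => (max 0 x) ^ p) (p * (max 0 x) ^ (p - 1)) x := by
  rcases lt_trichotomy x 0 with hx | rfl | hx
  · rw [max_eq_left hx.le, Real.zero_rpow (by linarith), mul_zero]
    refine (hasDerivAt_const x (0 : ℝ)).congr_of_eventuallyEq ?_
    filter_upwards [Iio_mem_nhds hx] with y hy
    rw [max_eq_left (le_of_lt hy), Real.zero_rpow (by linarith)]
  · rw [max_self, Real.zero_rpow (by linarith), mul_zero, ← hasDerivWithinAt_univ, ← Iic_union_Ici]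
    refine HasDerivWithinAt.union ?_ ?_
    · refine (hasDerivWithinAt_const (0 : ℝ) (Iic 0) (0 : ℝ)).congr (fun y hy => ?_) ?_
      · rw [max_eq_left hy, Real.zero_rpow (by linarith)]
      · rw [max_self, Real.zero_rpow (by linarith)]
    · have := (Real.hasDerivAt_rpow_const (x := 0) (Or.inr hp.le)).hasDerivWithinAt (s := Ici 0)
      rw [Real.zero_rpow (by linarith), mul_zero] at this
      refine this.congr (fun y hy => ?_) ?_
      · rw [max_eq_right hy]
      · rw [max_self]
  · rw [max_eq_right hx.le]
    refine (Real.hasDerivAt_rpow_const (Or.inl hx.ne')).congr_of_eventuallyEq ?_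
    filter_upwards [Ioi_mem_nhds hx] with y hy
    rw [max_eq_right (le_of_lt hy)]

theorem isSurvival_claytonPow_of_pos {b p : ℝ} (hb : 0 < b) (hp : p < 0) :
    IsSurvival (claytonPow b p) := by
  have hbase : ∀ s, 0 ≤ s → 1 ≤ 1 + b * s := fun s hs => by
    have := mul_nonneg hb.le hs
    linarith
  have heq : ∀ s, 0 ≤ s → claytonPow b p s = (1 + b * s) ^ p := fun s hs => by
    rw [claytonPow, max_eq_right (zero_le_one.trans (hbase s hs))]
  have hlt : ∀ s t, 0 ≤ s → s < t → claytonPow b p t < claytonPow b p s := by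
    intro s t hs hst
    rw [heq s hs, heq t (hs.trans hst.le)]
    have := hbase s hs
    exact Real.rpow_lt_rpow_of_neg (by linarith) (by nlinarith) hp
  refine ⟨fun s _ => Real.rpow_nonneg (le_max_left _ _) _, by simp [claytonPow], ?_, ?_, ?_,
    fun s t hs hst _ => hlt s t hs hst⟩
  · refine ContinuousOn.rpow_const (by fun_prop) fun s hs => Or.inl ?_
    have := hbase s hs
    rw [max_eq_right (by linarith)]
    linarith
  · have h1 : Tendsto (fun s : ℝ => 1 + b * s) atTop atTop :=
      tendsto_atTop_add_const_left _ _ (tendsto_id.const_mul_atTop hb)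
    have h2 := (tendsto_rpow_neg_atTop (neg_pos.2 hp)).comp h1
    rw [neg_neg] at h2
    refine h2.congr' ?_
    filter_upwards [eventually_ge_atTop 0] with s hs
    exact (heq s hs).symm
  · intro s hs t ht hst
    rcases hst.eq_or_lt with rfl | h
    · exact le_rfl
    · exact (hlt s t hs h).le

theorem isSurvival_claytonPow_of_neg {b p : ℝ} (hb : b < 0) (hp : 0 < p) :
    IsSurvival (claytonPow b p) := by
  refine ⟨fun s _ => Real.rpow_nonneg (le_max_left _ _) _, by simp [claytonPow], ?_, ?_, ?_, ?_⟩
  · exact ContinuousOn.rpow_const (by fun_prop) fun s hs => Or.inr hp.le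
  · refine tendsto_const_nhds.congr' ?_
    filter_upwards [eventually_ge_atTop (-1 / b)] with s hs
    have : b * s ≤ -1 := by rwa [div_le_iff_of_neg hb, mul_comm] at hs
    rw [claytonPow, max_eq_left (by linarith), Real.zero_rpow hp.ne']
  · intro s _ t _ hst
    exact Real.rpow_le_rpow (le_max_left _ _) (max_le_max le_rfl (by nlinarith)) hp.le
  · intro s t _ hst hpos
    have h1 : 0 < 1 + b * s := by
      by_contra! h
      rw [claytonPow, max_eq_left h, Real.zero_rpow hp.ne'] at hpos
      exact lt_irrefl _ hpos
    refine Real.rpow_lt_rpow (le_max_left _ _) ?_ hp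
    rw [max_eq_right h1.le]
    exact max_lt h1 (by nlinarith)

theorem hasSurvivalDensity_claytonPow {b p : ℝ} (h : 0 < b ∧ p < 0 ∨ b < 0 ∧ 1 < p) :
    HasSurvivalDensity (claytonPow b p) fun s => -(p * b) * claytonPow b (p - 1) s := by
  have hs : IsSurvival (claytonPow b p) := by
    rcases h with h | h
    · exact isSurvival_claytonPow_of_pos h.1 h.2
    · exact isSurvival_claytonPow_of_neg h.1 (by linarith [h.2])
  have hpb : p * b < 0 := by
    rcases h with h | h
    · exact mul_neg_of_neg_of_pos h.2 h.1
    · exact mul_neg_of_pos_of_neg (by linarith [h.2]) h.1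
  refine ⟨hs.map_zero, hs.continuousOn, hs.tendsto_zero, fun s hs0 => ?_, fun s hs0 => ?_, ?_⟩
  · have hlin : HasDerivAt (fun s => 1 + b * s) b s := by
      simpa using ((hasDerivAt_id s).const_mul b).const_add 1
    rcases h with h | h
    · have hbase : 0 < 1 + b * s := by
        have := mul_pos h.1 hs0
        linarith
      have h1 := hlin.rpow_const (p := p) (Or.inl hbase.ne')
      have h2 : HasDerivAt (claytonPow b p) (b * p * (1 + b * s) ^ (p - 1)) s := by
        refine h1.congr_of_eventuallyEq ?_
        filter_upwards [Ioi_mem_nhds hs0] with t ht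
        have := mul_pos h.1 ht
        rw [claytonPow, max_eq_right (by linarith)]
      convert! h2 using 1
      rw [claytonPow, max_eq_right hbase.le]
      ring
    · have h1 := (hasDerivAt_max_zero_rpow h.2 (1 + b * s)).comp s hlin
      convert! h1 using 1
      rw [claytonPow]
      ring
  · exact mul_nonneg (neg_nonneg.2 hpb.le) (Real.rpow_nonneg (le_max_left _ _) _)
  · refine continuousOn_const.mul (ContinuousOn.rpow_const (by fun_prop) fun s hs0 => ?_)
    rcases h with h | h
    · left
      have : 0 < b * s := mul_pos h.1 hs0
      rw [max_eq_right (by linarith)]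
      linarith
    · right
      linarith [h.2]

/-- The factorization 1 + b(t + s) = (1 + bt)(1 + b s/(1 + bt)) is what makes every Clayton tail a
rescaling of a single function. -/
theorem claytonPow_add {b q t : ℝ} (ht : 0 < 1 + b * t) (s : ℝ) :
    claytonPow b q (t + s) = claytonPow b q t * claytonPow b q (s / (1 + b * t)) := by
  have h1 : 1 + b * (t + s) = (1 + b * t) * (1 + b * (s / (1 + b * t))) := by
    field_simp
    ring
  rw [claytonPow, claytonPow, claytonPow, ← Real.mul_rpow (le_max_left _ _) (le_max_left _ _),
    max_eq_right ht.le, mul_max_of_nonneg _ _ ht.le, mul_zero, h1]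

theorem claytonPow_base_pos {b p t : ℝ} (h : 0 < b ∧ p < 0 ∨ b < 0 ∧ 1 < p) (ht : 0 < t)
    (hpos : 0 < -(p * b) * claytonPow b (p - 1) t) : 0 < 1 + b * t := by
  rcases h with h | h
  · have := mul_pos h.1 ht
    linarith
  · by_contra! hle
    rw [claytonPow, max_eq_left hle, Real.zero_rpow (by linarith [h.2]), mul_zero] at hpos
    exact lt_irrefl _ hpos

theorem isSurvival_exp {c : ℝ} (hc : 0 < c) : IsSurvival fun s => Real.exp (-(c * s)) where
  nonneg s _ := (Real.exp_pos _).le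
  map_zero := by simp
  continuousOn := by fun_prop
  tendsto_zero := Real.tendsto_exp_neg_atTop_nhds_zero.comp (tendsto_id.const_mul_atTop hc)
  antitoneOn s _ t _ hst := Real.exp_le_exp.2 (neg_le_neg (mul_le_mul_of_nonneg_left hst hc.le))
  lt_of_lt s t _ hst _ := Real.exp_lt_exp.2 (neg_lt_neg (mul_lt_mul_of_pos_left hst hc))

theorem hasSurvivalDensity_exp {c : ℝ} (hc : 0 < c) :
    HasSurvivalDensity (fun s => Real.exp (-(c * s))) fun s => c * Real.exp (-(c * s)) where
  map_zero := by simp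
  continuousOn := by fun_prop
  tendsto_zero := (isSurvival_exp hc).tendsto_zero
  hasDerivAt s _ := by
    have h1 : HasDerivAt (fun s => -(c * s)) (-c) s := by
      simpa using (hasDerivAt_id s).const_mul (-c)
    convert! h1.exp using 1
    ring
  density_nonneg s _ := by positivity
  density_continuousOn := by fun_prop

theorem IsMTCJ.conditionalCopulaConstant {d : ℕ} {φ : ℝ → ℝ} (h : IsMTCJ d φ)
    {μ : Measure (Fin d → ℝ)} [IsProbabilityMeasure μ] (hφ : IsSurvival φ)
    (hμ : IsArchimedeanCopulaLaw φ μ) {A D : Finset (Fin d)} (hA : 2 ≤ A.card)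
    (hAD : Disjoint A D) : ConditionalCopulaConstant μ A D := by
  obtain ⟨θ, c, hθ, hc, hgen⟩ := h
  have hcard : A.card + D.card ≤ d := by
    rw [← Finset.card_union_of_disjoint hAD]
    simpa using Finset.card_le_univ (A ∪ D)
  rcases eq_or_ne θ 0 with rfl | hθ0
  -- The exponential is memoryless: conditioning changes neither the generator nor the scale, hence
  -- b = 0 and a constant sequence ψ.
  · refine hμ.conditionalCopulaConstant hφ hAD (b := 0) (ψ := fun _ s => Real.exp (-(c * s)))
      (f := fun _ s => c * Real.exp (-(c * s))) (fun s hs => ?_) (fun k _ s _ => (Real.exp_pos _).le)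
      (isSurvival_exp hc) (fun k _ => hasSurvivalDensity_exp hc) fun k _ t _ _ => ⟨by simp, ?_⟩
    · rw [hgen s hs, mtcjGenerator, if_pos rfl]
    · intro s _
      rw [mul_add, neg_add, Real.exp_add]
      simp [mul_assoc]
  -- For θ < 0 the bound on θ says -1/θ ≥ d - 1. As |D| ≤ d - 2, the exponent -1/θ - k exceeds 1 for
  -- k < |D|, so the density exists at each conditioning, and it is still positive for k = |D|.
  · have hparam : ∀ k ≤ D.card, 0 < θ * c ∧ -1 / θ - k < 0 ∨ θ * c < 0 ∧
        (d : ℝ) - 1 - k ≤ -1 / θ - k := by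
      intro k hk
      rcases hθ0.lt_or_gt with hneg | hpos
      · right
        refine ⟨mul_neg_of_neg_of_pos hneg hc, ?_⟩
        have hd1 : (0 : ℝ) < d - 1 := by
          have : (2 : ℝ) ≤ d := by exact_mod_cast (by omega : 2 ≤ d)
          linarith
        rw [div_le_iff₀ hd1] at hθ
        have : (d : ℝ) - 1 ≤ -1 / θ := by
          rw [le_div_iff_of_neg hneg]
          linarith
        linarith
      · left
        refine ⟨mul_pos hpos hc, ?_⟩
        have : -1 / θ < 0 := div_neg_of_neg_of_pos (by norm_num) hpos
        have : (0 : ℝ) ≤ k := k.cast_nonneg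
        linarith
    have hcard' : (D.card : ℝ) + 2 ≤ d := by exact_mod_cast (by omega : D.card + 2 ≤ d)
    have hparam' : ∀ k < D.card, 0 < θ * c ∧ -1 / θ - k < 0 ∨ θ * c < 0 ∧ 1 < -1 / θ - k := by
      intro k hk
      refine (hparam k hk.le).imp_right fun h => ⟨h.1, ?_⟩
      have : (k : ℝ) + 1 ≤ D.card := by exact_mod_cast hk
      linarith [h.2]
    refine hμ.conditionalCopulaConstant hφ hAD (b := θ * c)
      (ψ := fun k => claytonPow (θ * c) (-1 / θ - k))
      (f := fun k s => -((-1 / θ - k) * (θ * c)) * claytonPow (θ * c) (-1 / θ - k - 1) s)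
      (fun s hs => ?_) (fun k _ s _ => Real.rpow_nonneg (le_max_left _ _) _) ?_
      (fun k hk => hasSurvivalDensity_claytonPow (hparam' k hk)) fun k hk t ht hft => ?_
    · rw [hgen s hs, mtcjGenerator, if_neg hθ0, claytonPow, Nat.cast_zero, sub_zero, mul_assoc]
    · rcases hparam D.card le_rfl with h | h
      · exact isSurvival_claytonPow_of_pos h.1 h.2
      · exact isSurvival_claytonPow_of_neg h.1 (by linarith [h.2])
    · have hbase := claytonPow_base_pos (hparam' k hk) ht hft
      refine ⟨hbase, fun s _ => ?_⟩
      rw [claytonPow_add hbase, Nat.cast_succ, sub_add_eq_sub_sub, ← mul_assoc]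

/-! ### The conditional copula given one variable -/

/-- A change of variables on both sides: since V is almost surely a function of τ(V), conditioning
on either is the same. It replaces conditioning on U_k by conditioning on X_k. -/
theorem condDistrib_comp_of_ae_eq {Ω α β γ δ : Type*} [MeasurableSpace Ω] [MeasurableSpace α]
    [MeasurableSpace β] [MeasurableSpace γ] [StandardBorelSpace γ] [Nonempty γ]
    [MeasurableSpace δ] [StandardBorelSpace δ] [Nonempty δ] {P : Measure Ω}
    [IsProbabilityMeasure P] {V : Ω → α} {Y : Ω → γ} {Y' : Ω → δ} {τ : α → β} {σ : β → α}
    {G : γ → δ} (hV : Measurable V) (hY : Measurable Y) (hτ : Measurable τ) (hσ : Measurable σ)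
    (hG : Measurable G) (hVσ : ∀ᵐ ω ∂P, V ω = σ (τ (V ω))) (hY' : Y' =ᵐ[P] fun ω => G (Y ω)) :
    ∀ᵐ v ∂(P.map V),
      condDistrib Y' V P v = (condDistrib Y (fun ω => τ (V ω)) P (τ v)).map G := by
  have hT : Measurable fun ω => τ (V ω) := hτ.comp hV
  set κ := condDistrib Y (fun ω => τ (V ω)) P with hκ
  have hYm : AEMeasurable Y' P := (hG.comp hY).aemeasurable.congr hY'.symm
  have key := condDistrib_ae_eq_of_measure_eq_compProd (μ := P) V hYm
    (κ := (κ.comap τ hτ).map G) (by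
    ext s hs
    have hs' : MeasurableSet ((fun p : β × γ => (σ p.1, G p.2)) ⁻¹' s) :=
      ((hσ.comp measurable_fst).prodMk (hG.comp measurable_snd)) hs
    have h1 : ∀ v, ((κ.comap τ hτ).map G) v (Prod.mk v ⁻¹' s) =
        κ (τ v) ((fun y => (v, G y)) ⁻¹' s) := by
      intro v
      rw [Kernel.map_apply _ hG, Kernel.comap_apply, Measure.map_apply hG
        (measurable_prodMk_left hs)]
      rfl
    rw [Measure.compProd_apply hs, lintegral_map (Kernel.measurable_kernel_prodMk_left hs) hV]
    simp_rw [h1]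
    have h2 : ∫⁻ ω, κ (τ (V ω)) ((fun y => (V ω, G y)) ⁻¹' s) ∂P =
        ∫⁻ ω, κ (τ (V ω)) (Prod.mk (τ (V ω)) ⁻¹' ((fun p : β × γ => (σ p.1, G p.2)) ⁻¹' s)) ∂P := by
      refine lintegral_congr_ae ?_
      filter_upwards [hVσ] with ω hω
      simp only [← preimage_comp, Function.comp_def, ← hω]
    rw [h2, ← lintegral_map (μ := P) (f := fun t => κ t (Prod.mk t ⁻¹'
        ((fun p : β × γ => (σ p.1, G p.2)) ⁻¹' s))) (Kernel.measurable_kernel_prodMk_left hs') hT,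
      ← Measure.compProd_apply hs', hκ, compProd_map_condDistrib hY.aemeasurable,
      Measure.map_apply (hT.prodMk hY) hs',
      Measure.map_apply_of_aemeasurable (hV.aemeasurable.prodMk hYm) hs]
    refine measure_congr (eventuallyEq_set.2 ?_)
    filter_upwards [hVσ, hY'] with ω h3 h4
    simp only [mem_preimage, ← h3, h4])
  filter_upwards [key] with v hv
  rw [hv, Kernel.map_apply _ hG, Kernel.comap_apply]

/-- A zero of φ at t would be a local minimum, where the derivative -f(t) vanishes. -/
theorem HasSurvivalDensity.pos_of_density_pos {φ f : ℝ → ℝ} (h : HasSurvivalDensity φ f) {t : ℝ}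
    (ht : 0 < t) (hft : 0 < f t) : 0 < φ t := by
  by_contra! hle
  have hmin : IsLocalMin φ t := by
    filter_upwards [Ioi_mem_nhds ht] with s hs
    exact hle.trans (h.nonneg (le_of_lt hs))
  have := hmin.hasDerivAt_eq_zero (h.hasDerivAt t ht)
  linarith

/-- If the copula of `(U_i, U_j)` given `U_k` is constant, then the survival functions
`f (t + ·) / f t` generate the same bivariate Archimedean copula for almost every `t`. -/
theorem IsArchimedeanCopulaLaw.exists_copula_eq {d : ℕ} {φ f : ℝ → ℝ}
    {μ : Measure (Fin d → ℝ)} [IsProbabilityMeasure μ] (hφ : IsSurvival φ)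
    (hf : HasSurvivalDensity φ f) (hμ : IsArchimedeanCopulaLaw φ μ) {A D : Finset (Fin d)}
    (hA : A.card = 2) (hD : D.card = 1) (hAD : Disjoint A D)
    (hC : ConditionalCopulaConstant μ A D) :
    ∃ C : ℝ → ℝ → ℝ, ∀ᵐ t ∂(volume : Measure ℝ), 0 < t → 0 < f t →
      ∀ a b, 0 ≤ a → 0 ≤ b → 0 < φ a → 0 < φ b →
        C (f (t + a) / f t) (f (t + b) / f t) = f (t + (a + b)) / f t := by
  obtain ⟨k, rfl⟩ := Finset.card_eq_one.1 hD
  obtain ⟨C, -, hC⟩ := hC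
  have hkA : k ∉ A := fun h => Finset.disjoint_left.1 hAD h (Finset.mem_singleton_self k)
  have hinv := hφ.measurable_survivalInv
  have hmem : ∀ᵐ z ∂μ, ∀ i, z i ∈ Ioo (0 : ℝ) 1 := ae_all_iff.2 hμ.isCopulaLaw.ae_mem_Ioo
  let V : (Fin d → ℝ) → ({k} : Finset (Fin d)) → ℝ := fun z => Finset.restrict {k} z
  let τ : (({k} : Finset (Fin d)) → ℝ) → ℝ := fun v =>
    survivalInv φ (v ⟨k, Finset.mem_singleton_self k⟩)
  let σ : ℝ → ({k} : Finset (Fin d)) → ℝ := fun t _ => φ (max t 0)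
  let Y : (Fin d → ℝ) → A → ℝ := fun z i => survivalInv φ (z i)
  let G : (A → ℝ) → A → ℝ := fun y i => φ (max (y i) 0)
  have hVm : Measurable V := Finset.measurable_restrict _
  have hYm : Measurable Y := by fun_prop
  have hτ : Measurable τ := by fun_prop
  have hσ : Measurable σ := measurable_pi_lambda _ fun _ => hφ.continuous_comp_max.measurable
  have hG : Measurable G := measurable_pi_lambda _ fun i =>
    hφ.continuous_comp_max.measurable.comp (measurable_pi_apply i)
  have hinv' : ∀ u ∈ Ioo (0 : ℝ) 1, φ (max (survivalInv φ u) 0) = u := fun u hu => by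
    rw [max_eq_left (IsSurvival.survivalInv_nonneg φ u), hφ.apply_survivalInv hu]
  have hVσ : ∀ᵐ z ∂μ, V z = σ (τ (V z)) := by
    filter_upwards [hmem] with z hz
    ext ⟨i, hi⟩
    obtain rfl := Finset.mem_singleton.1 hi
    exact (hinv' _ (hz i)).symm
  have hY' : (fun z : Fin d → ℝ => A.restrict z) =ᵐ[μ] fun z => G (Y z) := by
    filter_upwards [hmem] with z hz
    ext i
    exact (hinv' _ (hz i)).symm
  let T : (Fin d → ℝ) → ℝ := fun z => τ (V z)
  have hT : Measurable T := hτ.comp hVm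
  have hS : ∀ t y, 0 ≤ t → 0 ≤ y → μ.real {z | t ≤ T z ∧ y ≤ Y z} = φ (t + ∑ i, y i) := by
    intro t y ht hy
    -- Coordinates outside A and k get threshold 0 and are thereby integrated out.
    let x : Fin d → ℝ := fun i => if h : i ∈ A then y ⟨i, h⟩ else if i = k then t else 0
    have hx : 0 ≤ x := by
      intro i
      by_cases hi : i ∈ A
      · simpa [x, hi] using hy ⟨i, hi⟩
      · by_cases hik : i = k <;> simp [x, hi, hik, hkA, ht]
    have hsum : ∑ i, x i = t + ∑ i, y i := by
      rw [← Finset.sum_compl_add_sum A]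
      congr 1
      · rw [Finset.sum_congr rfl (g := fun i => if i = k then t else 0)]
        · simp [hkA]
        · intro i hi
          simp [x, Finset.mem_compl.1 hi]
      · rw [Finset.sum_subtype A (p := fun i => i ∈ A) (by simp)]
        refine Finset.sum_congr rfl fun i _ => ?_
        simp [x]
    rw [← hsum, ← hμ.measureReal_le_survivalInv hφ hx]
    congr 1
    ext z
    constructor
    · rintro ⟨h1, h2⟩ i
      by_cases hi : i ∈ A
      · simpa [x, hi] using h2 ⟨i, hi⟩
      · by_cases hik : i = k
        · subst hik
          have h3 : t ≤ survivalInv φ (z i) := h1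
          simpa [x, hi] using h3
        · simpa [x, hi, hik] using IsSurvival.survivalInv_nonneg φ (z i)
    · intro h1
      have h3 : t ≤ survivalInv φ (z k) := by simpa [x, hkA] using h1 k
      refine ⟨h3, fun i => ?_⟩
      simpa [x] using h1 i
  have hmapV : μ.map V = (μ.map T).map σ := by
    rw [Measure.map_map hσ hT]
    exact Measure.map_congr hVσ
  have hcouple : ∀ᵐ v ∂(μ.map V), Couples C ((condDistrib Y T μ (τ v)).map G) := by
    filter_upwards [hC, condDistrib_comp_of_ae_eq hVm hYm hτ hσ hG hVσ hY'] with v h1 h2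
    rw [← h2]
    exact h1
  rw [hmapV] at hcouple
  have hcouple' := ae_of_ae_map hσ.aemeasurable hcouple
  obtain ⟨i₀, i₁, hne, rfl⟩ := Finset.card_eq_two.1 hA
  refine ⟨fun a b => C fun i => if i.1 = i₀ then a else b, ?_⟩
  have hae := hcouple'.and (hf.condDistrib_Ici hT hYm hS)
  have hf0 : AEMeasurable (fun t => ENNReal.ofReal (f t)) (volume.restrict (Ioi 0)) := by
    simpa using hf.aemeasurable le_rfl
  rw [hf.map_eq hT hYm hS, ae_withDensity_iff' hf0, ae_restrict_iff' measurableSet_Ioi] at hae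
  filter_upwards [hae] with t ht ht0 hft a b ha hb hφa hφb
  obtain ⟨h1, -, -, h2⟩ := ht ht0 (ENNReal.ofReal_pos.2 hft).ne'
  have hτσ : τ (σ t) = t := by
    change survivalInv φ (φ (max t 0)) = t
    rw [max_eq_left ht0.le]
    refine hφ.survivalInv_apply ht0.le ⟨hf.pos_of_density_pos ht0 hft, ?_⟩
    rw [← hφ.map_zero]
    exact hφ.lt_of_lt 0 t le_rfl ht0 (by simp [hφ.map_zero])
  rw [hτσ] at h1
  set κ := condDistrib Y T μ t with hκ
  have hκ0 : ∀ᵐ y ∂κ, 0 ≤ y := by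
    refine ae_of_measureReal_eq_one (measurableSet_Ici_pi _) ?_
    change κ.real (Ici 0) = 1
    rw [h2 0 le_rfl]
    simp [hft.ne']
  let s : ({i₀, i₁} : Finset (Fin d)) → ℝ := fun i => if i.1 = i₀ then a else b
  have hs0 : ∀ i, 0 ≤ s i := fun i => by
    by_cases hi : i.1 = i₀ <;> simp [s, hi, ha, hb]
  have hsφ : ∀ i, 0 < φ (s i) := fun i => by
    by_cases hi : i.1 = i₀ <;> simp [s, hi, hφa, hφb]
  -- φ is injective only where it is positive, hence the restriction to arguments with φ(a), φ(b) >
  -- 0.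
  have hiff : ∀ y : ({i₀, i₁} : Finset (Fin d)) → ℝ, 0 ≤ y → ∀ i, G y i ≤ φ (s i) ↔ s i ≤ y i := by
    intro y hy i
    change φ (max (y i) 0) ≤ φ (s i) ↔ _
    rw [max_eq_left (show (0 : ℝ) ≤ y i from hy i)]
    refine ⟨fun hle => ?_, fun hle => hφ.antitoneOn (hs0 i) (hy i) hle⟩
    by_contra! hlt
    exact absurd hle (hφ.lt_of_lt _ _ (hy i) hlt
      ((hsφ i).trans_le (hφ.antitoneOn (hy i) (hs0 i) hlt.le))).not_ge
  have hjoint : (κ.map G).real (Iic fun i => φ (s i)) = f (t + (a + b)) / f t := by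
    have hsum : ∑ i, s i = a + b := by
      change ∑ i : ({i₀, i₁} : Finset (Fin d)), (fun i => if i = i₀ then a else b) i.1 = _
      rw [Finset.sum_coe_sort {i₀, i₁} (fun i => if i = i₀ then a else b), Finset.sum_pair hne]
      simp [hne.symm]
    rw [← hsum, ← h2 s hs0, map_measureReal_apply hG isClosed_Iic.measurableSet]
    refine measureReal_congr (eventuallyEq_set.2 ?_)
    filter_upwards [hκ0] with y hy
    exact forall_congr' (hiff y hy)
  have hmargin : ∀ i, (κ.map G).real {z | z i ≤ φ (s i)} = f (t + s i) / f t := by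
    intro i
    have h3 : MeasurableSet {z : ({i₀, i₁} : Finset (Fin d)) → ℝ | z i ≤ φ (s i)} :=
      measurable_pi_apply i measurableSet_Iic
    have h4 := h2 (Pi.single i (s i)) (Pi.single_nonneg.2 (hs0 i))
    rw [Finset.sum_pi_single', if_pos (Finset.mem_univ _)] at h4
    rw [← h4, map_measureReal_apply hG h3]
    refine measureReal_congr (eventuallyEq_set.2 ?_)
    filter_upwards [hκ0] with y hy
    refine (hiff y hy i).trans ⟨fun hle j => ?_, fun hle => by simpa using hle i⟩
    by_cases hj : j = i
    · subst hj
      simpa using hle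
    · rw [Pi.single_eq_of_ne hj]
      exact hy j
  -- As φ is decreasing, the distribution function of φ(Y) at φ(s) is the survival function of Y at
  -- s, so the coupling identity becomes one between tails of f.
  have h3 := h1 fun i => φ (s i)
  rw [hjoint] at h3
  rw [h3]
  refine congrArg C (funext fun i => ?_)
  rw [hmargin i]
  by_cases hi : i.1 = i₀ <;> simp [s, hi]

/-! ### Functional equations -/

/-- Two survival functions that generate the same bivariate copula are rescalings of each other;
the scale is read off from the derivatives at `0`. -/
theorem IsSurvival.mul_eq_mul_of_copula_eq {H₁ H₂ : ℝ → ℝ} (h₁ : IsSurvival H₁)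
    (h₂ : IsSurvival H₂) {C : ℝ → ℝ → ℝ}
    (hC₁ : ∀ a b, 0 ≤ a → 0 ≤ b → 0 < H₁ a → 0 < H₁ b → C (H₁ a) (H₁ b) = H₁ (a + b))
    (hC₂ : ∀ a b, 0 ≤ a → 0 ≤ b → 0 < H₂ a → 0 < H₂ b → C (H₂ a) (H₂ b) = H₂ (a + b))
    {r₁ r₂ : ℝ} (hr₁ : HasDerivAt H₁ (-r₁) 0) (hr₂ : HasDerivAt H₂ (-r₂) 0) {a w : ℝ}
    (ha : 0 ≤ a) (hw : 0 ≤ w) (hpos : 0 < H₁ a) (heq : H₁ a = H₂ w) : r₁ * a = r₂ * w := by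
  -- Choose y with H₂(y) = H₁(a/(n+1)). Adding this argument repeatedly through C gives H₂(k y) =
  -- H₁(k a/(n+1)); at k = n + 1 injectivity forces (n+1) y = w. The points 1/(n+1) tend to 0, so
  -- the derivatives along the two rays agree.
  have key : ∀ n : ℕ, H₁ ((1 / ((n : ℝ) + 1)) * a) = H₂ ((1 / ((n : ℝ) + 1)) * w) := by
    intro n
    have hn : (0 : ℝ) < n + 1 := n.cast_add_one_pos
    set x := (1 / ((n : ℝ) + 1)) * a with hx
    have hx0 : 0 ≤ x := by positivity
    have hkx : ∀ k : ℕ, k ≤ n + 1 → k * x ≤ a := by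
      intro k hk
      have hk' : (k : ℝ) ≤ n + 1 := by exact_mod_cast hk
      calc k * x ≤ (n + 1) * x := mul_le_mul_of_nonneg_right hk' hx0
        _ = a := by rw [hx]; field_simp
    have hposk : ∀ k : ℕ, k ≤ n + 1 → 0 < H₁ (k * x) := fun k hk =>
      hpos.trans_le (h₁.antitoneOn (mem_Ici.2 (by positivity)) ha (hkx k hk))
    have hpos1 : 0 < H₁ x := by simpa using hposk 1 (by omega)
    obtain ⟨y, hy0, hy⟩ := h₂.exists_eq ⟨hpos1, h₁.le_one hx0⟩
    have hind : ∀ k : ℕ, k ≤ n + 1 → H₂ (k * y) = H₁ (k * x) := by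
      intro k
      induction k with
      | zero => simp [h₁.map_zero, h₂.map_zero]
      | succ k ih =>
        intro hk
        have hk' := ih (by omega)
        have hp := hposk k (by omega)
        rw [Nat.cast_succ, add_mul, add_mul, one_mul, one_mul,
          ← hC₁ _ _ (by positivity) hx0 hp hpos1,
          ← hC₂ _ _ (by positivity) hy0 (hk' ▸ hp) (hy ▸ hpos1), hk', hy]
    have hlast := hind (n + 1) le_rfl
    have hxa : ((n + 1 : ℕ) : ℝ) * x = a := by
      rw [hx]
      push_cast
      field_simp
    rw [hxa, heq] at hlast
    have hyw : ((n + 1 : ℕ) : ℝ) * y = w :=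
      (h₂.injOn hw (by positivity) (heq ▸ hpos) hlast.symm).symm
    rw [← hy, ← hyw]
    congr 1
    push_cast
    field_simp
  have hlin : ∀ c : ℝ, HasDerivAt (fun s : ℝ => s * c) c 0 := fun c => by
    simpa using (hasDerivAt_id (0 : ℝ)).mul_const c
  have hd₁ : HasDerivAt (fun s => H₁ (s * a)) (-r₁ * a) 0 := by
    have : HasDerivAt H₁ (-r₁) (0 * a) := by rwa [zero_mul]
    exact this.comp 0 (hlin a)
  have hd₂ : HasDerivAt (fun s => H₂ (s * w)) (-r₂ * w) 0 := by
    have : HasDerivAt H₂ (-r₂) (0 * w) := by rwa [zero_mul]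
    exact this.comp 0 (hlin w)
  have hd := (hd₁.sub hd₂).tendsto_slope
  have hseq : Tendsto (fun n : ℕ => 1 / ((n : ℝ) + 1)) atTop (𝓝[≠] 0) := by
    refine tendsto_nhdsWithin_iff.2 ⟨tendsto_one_div_add_atTop_nhds_zero_nat, ?_⟩
    exact Eventually.of_forall fun n => (Nat.one_div_pos_of_nat (α := ℝ)).ne'
  have hlim := hd.comp hseq
  have hzero : (slope ((fun s => H₁ (s * a)) - fun s => H₂ (s * w)) 0 ∘
      fun n : ℕ => 1 / ((n : ℝ) + 1)) = fun _ => 0 := by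
    ext n
    simp [slope_def_field, key n, h₁.map_zero, h₂.map_zero, -one_div]
  rw [hzero] at hlim
  have := tendsto_nhds_unique hlim tendsto_const_nhds
  linarith

/-- The positive continuous solutions on `[0, ∞)` of the Gołąb–Schinzel equation are affine. -/
theorem golab_schinzel {M : ℝ → ℝ} (hcont : ContinuousOn M (Ici 0)) (hpos : ∀ v, 0 ≤ v → 0 < M v)
    (hM : ∀ u v, 0 ≤ u → 0 ≤ v → M (v + u * M v) = M v * M u) :
    ∃ c, ∀ v, 0 ≤ v → M v = 1 + c * v := by
  by_cases hinj : InjOn M (Ici 0)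
  · refine ⟨M 1 - 1, fun v hv => ?_⟩
    have h1 := hM 1 v zero_le_one hv
    rw [mul_comm (M v), ← hM v 1 hv zero_le_one] at h1
    have h2 := hinj (mem_Ici.2 (by have := hpos v hv; positivity))
      (mem_Ici.2 (by have := hpos 1 zero_le_one; positivity)) h1
    linarith
  · obtain ⟨x, y, hx, hxy, hMxy⟩ : ∃ x y, 0 ≤ x ∧ x < y ∧ M x = M y := by
      simp only [InjOn, not_forall] at hinj
      obtain ⟨x, hx, y, hy, h, hne⟩ := hinj
      rcases lt_or_gt_of_ne hne with hlt | hlt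
      · exact ⟨x, y, hx, hlt, h⟩
      · exact ⟨y, x, hy, hlt, h.symm⟩
    have hy : 0 ≤ y := hx.trans hxy.le
    -- The equations based at x and at y have the same values on the right, so M has period y - x on
    -- [x, ∞) and attains its extrema over [0, ∞). The equation at u = v then gives max² ≤ max and
    -- min ≤ min², so M is identically 1.
    have hper : ∀ s, x ≤ s → M (s + (y - x)) = M s := by
      intro s hs
      have hMx := hpos x hx
      have hu : 0 ≤ (s - x) / M x := div_nonneg (sub_nonneg.2 hs) hMx.le
      have h1 := hM _ x hu hx
      have h2 := hM _ y hu hy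
      rw [← hMxy, ← h1, div_mul_cancel₀ _ hMx.ne'] at h2
      rw [show s + (y - x) = y + (s - x) by ring, h2]
      congr 1
      ring
    have hcpt : ContinuousOn M (Icc 0 y) := hcont.mono Icc_subset_Ici_self
    have hreduce : ∀ s, 0 ≤ s → ∃ s' ∈ Icc 0 y, M s' = M s := by
      intro s hs
      obtain ⟨n, hn⟩ := exists_nat_ge ((s - y) / (y - x))
      rw [div_le_iff₀ (sub_pos.2 hxy)] at hn
      induction n generalizing s with
      | zero => exact ⟨s, ⟨hs, by simp at hn; linarith⟩, rfl⟩
      | succ n ih =>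
        by_cases hsy : s ≤ y
        · exact ⟨s, ⟨hs, hsy⟩, rfl⟩
        · push Not at hsy
          push_cast at hn
          obtain ⟨s', hs', h⟩ := ih (s - (y - x)) (by linarith) (by linarith)
          refine ⟨s', hs', h.trans ?_⟩
          rw [← hper (s - (y - x)) (by linarith), sub_add_cancel]
    obtain ⟨v, hv, hmax⟩ := isCompact_Icc.exists_isMaxOn (nonempty_Icc.2 hy) hcpt
    obtain ⟨w, hw, hmin⟩ := isCompact_Icc.exists_isMinOn (nonempty_Icc.2 hy) hcpt
    have hle : ∀ s, 0 ≤ s → M s ≤ M v := fun s hs => by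
      obtain ⟨s', hs', h⟩ := hreduce s hs
      exact h ▸ hmax hs'
    have hge : ∀ s, 0 ≤ s → M w ≤ M s := fun s hs => by
      obtain ⟨s', hs', h⟩ := hreduce s hs
      exact h ▸ hmin hs'
    have hv0 := hpos v hv.1
    have hw0 := hpos w hw.1
    have h1 : M v * M v ≤ M v := by
      rw [← hM v v hv.1 hv.1]
      exact hle _ (by have := hv.1; positivity)
    have h2 : M w ≤ M w * M w := by
      rw [← hM w w hw.1 hw.1]
      exact hge _ (by have := hw.1; positivity)
    have h3 : M v ≤ 1 := by nlinarith
    have h4 : 1 ≤ M w := by nlinarith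
    refine ⟨0, fun s hs => ?_⟩
    have := hle s hs
    have := hge s hs
    linarith

/-! ### Powers that are Archimedean generators -/

/-- `(1 - s / s₀)_+ ^ p` generates a `d`-dimensional Archimedean copula only for `p ≥ d - 1`. -/
theorem IsArchimedeanGenerator.le_exponent {d : ℕ} {φ : ℝ → ℝ} (hd : 2 ≤ d)
    (h : IsArchimedeanGenerator d φ) {s₀ p : ℝ} (hs₀ : 0 < s₀) (hp : 0 < p)
    (hφ : ∀ s, 0 ≤ s → φ s = (max 0 (1 - s / s₀)) ^ p) : (d : ℝ) - 1 ≤ p := by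
  have hcontAt : ∀ j ≤ d - 2, ContinuousAt (iteratedDeriv j φ) s₀ := by
    intro j hj
    rcases hj.eq_or_lt with rfl | hj
    · have h1 := (h.convexOn.continuousOn isOpen_Ioi).continuousAt (Ioi_mem_nhds hs₀)
      have h2 := h1.const_mul ((-1 : ℝ) ^ (d - 2))
      refine h2.congr (Eventually.of_forall fun s => ?_)
      simp only
      rw [← mul_assoc, ← pow_add, Even.neg_one_pow ⟨d - 2, rfl⟩, one_mul]
    · exact ((h.differentiableOn j hj).differentiableAt (Ioi_mem_nhds hs₀)).continuousAt
  -- To the right of s₀ the derivatives vanish, to the left they are multiples of (1 - s/s₀)^(p-j).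
  -- Continuity at s₀ up to order d - 2 therefore forces p > j at each stage.
  have key : ∀ j ≤ d - 2, (j : ℝ) < p ∧ (∀ s, s₀ ≤ s → iteratedDeriv j φ s = 0) ∧
      ∃ K, 0 < K ∧ ∀ s, 0 < s → s < s₀ →
        iteratedDeriv j φ s = (-1) ^ j * (K * (1 - s / s₀) ^ (p - j)) := by
    intro j
    induction j with
    | zero =>
      intro _
      refine ⟨by simpa using hp, fun s hs => ?_, 1, one_pos, fun s hs hs' => ?_⟩
      · have : 1 - s / s₀ ≤ 0 := by rw [sub_nonpos, one_le_div hs₀]; exact hs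
        rw [iteratedDeriv_zero, hφ s (hs₀.le.trans hs), max_eq_left this, Real.zero_rpow hp.ne']
      · have : 0 < 1 - s / s₀ := by rw [sub_pos, div_lt_one hs₀]; exact hs'
        rw [iteratedDeriv_zero, hφ s hs.le, max_eq_right this.le]
        simp
    | succ j ih =>
      intro hj
      obtain ⟨hjp, hzero, K, hK, hform⟩ := ih (by omega)
      have hzero' : ∀ s, s₀ < s → iteratedDeriv (j + 1) φ s = 0 := by
        intro s hs
        rw [iteratedDeriv_succ]
        have : iteratedDeriv j φ =ᶠ[𝓝 s] fun _ => 0 := by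
          filter_upwards [Ioi_mem_nhds hs] with t ht
          exact hzero t (le_of_lt ht)
        rw [this.deriv_eq, deriv_const]
      have hform' : ∀ s, 0 < s → s < s₀ → iteratedDeriv (j + 1) φ s =
          (-1) ^ (j + 1) * (K * (p - j) / s₀ * (1 - s / s₀) ^ (p - (j + 1 : ℕ))) := by
        intro s hs hs'
        have hbase : 0 < 1 - s / s₀ := by rw [sub_pos, div_lt_one hs₀]; exact hs'
        rw [iteratedDeriv_succ]
        have heq : iteratedDeriv j φ =ᶠ[𝓝 s]
            fun t => (-1) ^ j * (K * (1 - t / s₀) ^ (p - j)) := by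
          filter_upwards [Ioo_mem_nhds hs hs'] with t ht
          exact hform t ht.1 ht.2
        have hlin : HasDerivAt (fun t => 1 - t / s₀) (-(1 / s₀)) s :=
          ((hasDerivAt_id s).div_const s₀).const_sub 1
        have := ((hlin.rpow_const (p := p - j) (Or.inl hbase.ne')).const_mul K).const_mul
          ((-1 : ℝ) ^ j)
        rw [heq.deriv_eq, this.deriv, pow_succ]
        push_cast
        rw [sub_sub]
        ring
      have hs₀0 : iteratedDeriv (j + 1) φ s₀ = 0 := by
        have h1 : Tendsto (iteratedDeriv (j + 1) φ) (𝓝[>] s₀) (𝓝 (iteratedDeriv (j + 1) φ s₀)) :=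
          (hcontAt (j + 1) hj).mono_left nhdsWithin_le_nhds
        refine tendsto_nhds_unique h1 (tendsto_const_nhds.congr' ?_)
        filter_upwards [self_mem_nhdsWithin] with s hs
        exact (hzero' s hs).symm
      have hK' : 0 < K * (p - j) / s₀ := div_pos (mul_pos hK (sub_pos.2 hjp)) hs₀
      refine ⟨?_, fun s hs => ?_, _, hK', hform'⟩
      · by_contra! hle
        have h1 : Tendsto (fun s => |iteratedDeriv (j + 1) φ s|) (𝓝[<] s₀) (𝓝 0) := by
          have := ((hcontAt (j + 1) hj).mono_left (nhdsWithin_le_nhds (s := Iio s₀))).abs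
          rwa [hs₀0, abs_zero] at this
        refine absurd (ge_of_tendsto h1 ?_) hK'.not_ge
        filter_upwards [Ioo_mem_nhdsLT hs₀] with s hs
        have hbase : 0 < 1 - s / s₀ := by rw [sub_pos, div_lt_one hs₀]; exact hs.2
        have hbase1 : 1 - s / s₀ ≤ 1 := sub_le_self _ (div_nonneg hs.1.le hs₀.le)
        rw [hform' s hs.1 hs.2, abs_mul, abs_pow, abs_neg, abs_one, one_pow, one_mul, abs_mul,
          abs_of_pos hK', abs_of_pos (Real.rpow_pos_of_pos hbase _)]
        exact le_mul_of_one_le_right hK'.le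
          (Real.one_le_rpow_of_pos_of_le_one_of_nonpos hbase hbase1 (sub_nonpos.2 hle))
      · rcases hs.eq_or_lt with rfl | hs
        · exact hs₀0
        · exact hzero' s hs
  obtain ⟨hlt, hzero, K, hK, hform⟩ := key (d - 2) le_rfl
  have hsign : ∀ x : ℝ, (-1 : ℝ) ^ (d - 2) * ((-1) ^ (d - 2) * x) = x := fun x => by
    rw [← mul_assoc, ← pow_add, Even.neg_one_pow ⟨d - 2, rfl⟩, one_mul]
  set q := p - (d - 2 : ℕ) with hq
  -- Midpoint convexity between s₀/2 and s₀ reads K 4^(-q) ≤ K 2^(-q) / 2, that is q ≥ 1, which is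
  -- the last unit beyond p > d - 2.
  have hconv := h.convexOn.2 (mem_Ioi.2 (half_pos hs₀)) (mem_Ioi.2 hs₀)
    (by norm_num : (0 : ℝ) ≤ 1 / 2) (by norm_num : (0 : ℝ) ≤ 1 / 2) (by norm_num)
  simp only [smul_eq_mul] at hconv
  rw [hzero s₀ le_rfl, hform (s₀ / 2) (by positivity) (by linarith),
    hform (1 / 2 * (s₀ / 2) + 1 / 2 * s₀) (by positivity) (by linarith), hsign, hsign,
    show 1 - s₀ / 2 / s₀ = 1 / 2 by field_simp; norm_num,
    show 1 - (1 / 2 * (s₀ / 2) + 1 / 2 * s₀) / s₀ = 1 / 2 * (1 / 2) by field_simp; norm_num,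
    Real.mul_rpow (by norm_num) (by norm_num)] at hconv
  have hx : 0 < ((1 : ℝ) / 2) ^ q := Real.rpow_pos_of_pos (by norm_num) _
  have h1 : ((1 : ℝ) / 2) ^ q ≤ (1 / 2) ^ (1 : ℝ) := by
    rw [Real.rpow_one]
    have : K * ((1 / 2) ^ q * (1 / 2) ^ q) ≤ K * ((1 / 2) ^ q * (1 / 2)) := by linarith
    exact le_of_mul_le_mul_left (le_of_mul_le_mul_left this hK) hx
  have h2 := (Real.rpow_le_rpow_left_iff_of_base_lt_one (by norm_num) (by norm_num)).1 h1
  rw [hq, Nat.cast_sub hd] at h2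
  push_cast at h2
  linarith

/-! ### Regularity of the density and its tails -/

/-- A survival function `φ` with density `f` that is decreasing to `0` and continuously
differentiable where positive, with derivative `-g < 0`. -/
structure IsSmoothSurvival (φ f g : ℝ → ℝ) : Prop where
  isSurvival : IsSurvival φ
  hasSurvivalDensity : HasSurvivalDensity φ f
  density_pos : ∀ t, 0 < t → 0 < φ t → 0 < f t
  tail : ∀ t, 0 < t → 0 < f t → IsSurvival fun s => f (t + s) / f t
  hasDerivAt_density : ∀ t, 0 < t → 0 < φ t → HasDerivAt f (-g t) t
  neg_deriv_pos : ∀ t, 0 < t → 0 < φ t → 0 < g t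
  neg_deriv_continuousOn : ContinuousOn g {t | 0 < t ∧ 0 < φ t}
  tendsto_mul_density : Tendsto (fun t => t * f t) atTop (𝓝 0)

theorem IsSurvival.isOpen_pos {φ : ℝ → ℝ} (h : IsSurvival φ) : IsOpen {t | 0 < t ∧ 0 < φ t} :=
  (h.continuousOn.mono Ioi_subset_Ici_self).isOpen_inter_preimage isOpen_Ioi isOpen_Ioi

theorem IsArchimedeanGenerator.isSmoothSurvival {d : ℕ} {φ : ℝ → ℝ} (hd : 3 ≤ d)
    (h : IsArchimedeanGenerator d φ) (h2 : IsC2WherePos φ) :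
    IsSmoothSurvival φ (fun s => -deriv φ s) (fun s => deriv (deriv φ) s) := by
  have hφ := h.isSurvival hd
  have hf := h.hasSurvivalDensity hd
  have hanti := h.antitoneOn_neg_deriv hd
  have hconv := h.convexOn_neg_deriv hd
  set f : ℝ → ℝ := fun s => -deriv φ s with hfdef
  have hpos : ∀ t, 0 < t → 0 < φ t → 0 < f t := by
    intro t ht hφt
    by_contra! hle
    have h1 := hf.lintegral_Ioi ht.le
    rw [setLIntegral_congr_fun (g := fun _ => 0) measurableSet_Ioi fun s hs =>
      ENNReal.ofReal_of_nonpos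
        ((hanti (mem_Ioi.2 ht) (mem_Ioi.2 (ht.trans hs)) (le_of_lt hs)).trans hle),
      lintegral_zero] at h1
    exact absurd (ENNReal.ofReal_eq_zero.1 h1.symm) hφt.not_ge
  -- By the mean value theorem and monotonicity of f, (t/2) f(t) ≤ φ(t/2) - φ(t).
  have hmul : Tendsto (fun t => t * f t) atTop (𝓝 0) := by
    have hhalf : Tendsto (fun t : ℝ => t / 2) atTop atTop := tendsto_id.atTop_div_const two_pos
    have hlim : Tendsto (fun t => 2 * (φ (t / 2) - φ t)) atTop (𝓝 0) := by
      simpa using ((hφ.tendsto_zero.comp hhalf).sub hφ.tendsto_zero).const_mul 2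
    refine squeeze_zero' ?_ ?_ hlim
    · filter_upwards [eventually_gt_atTop 0] with t ht
      exact mul_nonneg ht.le (hf.density_nonneg t ht)
    · filter_upwards [eventually_gt_atTop 0] with t ht
      obtain ⟨c, hc, hslope⟩ := exists_hasDerivAt_eq_slope φ (fun s => -f s) (half_lt_self ht)
        (hφ.continuousOn.mono fun s hs => (half_pos ht).le.trans hs.1)
        fun s hs => hf.hasDerivAt s ((half_pos ht).trans hs.1)
      have hle : f t ≤ f c :=
        hanti (mem_Ioi.2 ((half_pos ht).trans hc.1)) (mem_Ioi.2 ht) hc.2.le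
      rw [eq_div_iff (by linarith)] at hslope
      nlinarith
  have hlim0 : Tendsto f atTop (𝓝 0) := by
    refine squeeze_zero' ?_ ?_ hmul
    · filter_upwards [eventually_gt_atTop 0] with t ht
      exact hf.density_nonneg t ht
    · filter_upwards [eventually_ge_atTop 1] with t ht
      exact le_mul_of_one_le_left (hf.density_nonneg t (by linarith)) ht
  -- If f took the same value at s < t, convexity would keep f at or above it beyond t,
  -- contradicting f → 0.
  have hstrict : ∀ s t, 0 < s → s < t → 0 < f s → f t < f s := by
    intro s t hs hst hfs
    refine lt_of_le_of_ne (hanti (mem_Ioi.2 hs) (mem_Ioi.2 (hs.trans hst)) hst.le) fun heq => ?_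
    refine absurd (ge_of_tendsto hlim0 ?_) hfs.not_ge
    filter_upwards [eventually_gt_atTop t] with u hu
    have := hconv.slope_mono_adjacent (mem_Ioi.2 hs) (mem_Ioi.2 ((hs.trans hst).trans hu)) hst hu
    rw [heq, sub_self, zero_div, le_div_iff₀ (sub_pos.2 hu)] at this
    linarith
  have hd2 : ContDiffOn ℝ 1 (deriv φ) {t | 0 < t ∧ 0 < φ t} :=
    h2.deriv_of_isOpen hφ.isOpen_pos (by norm_num)
  have hder : ∀ t, 0 < t → 0 < φ t → HasDerivAt f (-deriv (deriv φ) t) t := fun t ht hφt =>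
    ((hd2.differentiableOn one_ne_zero).differentiableAt
      (hφ.isOpen_pos.mem_nhds ⟨ht, hφt⟩)).hasDerivAt.neg
  refine ⟨hφ, hf, hpos, fun t ht hft => ?_, hder, fun t ht hφt => ?_,
    hd2.continuousOn_deriv_of_isOpen hφ.isOpen_pos le_rfl, hmul⟩
  · have hadd : ∀ s, 0 ≤ s → 0 < t + s := fun s hs => add_pos_of_pos_of_nonneg ht hs
    refine ⟨fun s hs => div_nonneg (hf.density_nonneg _ (hadd s hs)) hft.le, by simp [hft.ne'],
      ?_, ?_, fun s hs s' hs' hss' => ?_, fun s s' hs hss' hp => ?_⟩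
    · exact (hf.density_continuousOn.comp (by fun_prop) fun s hs => hadd s hs).div_const _
    · simpa using (hlim0.comp (tendsto_atTop_add_const_left _ t tendsto_id)).div_const (f t)
    · exact div_le_div_of_nonneg_right
        (hanti (mem_Ioi.2 (hadd s hs)) (mem_Ioi.2 (hadd s' hs')) (by linarith)) hft.le
    · exact div_lt_div_of_pos_right (hstrict _ _ (hadd s hs) (by linarith)
        ((div_pos_iff_of_pos_right hft).1 hp)) hft
  -- The tangent at t lies below the chord to t + 1, whose slope is negative by strict decrease.
  · have h3 := hconv.le_slope_of_hasDerivAt (mem_Ioi.2 ht) (mem_Ioi.2 (by linarith : 0 < t + 1))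
      (by linarith) (hder t ht hφt)
    have h4 := hstrict t (t + 1) ht (by linarith) (hpos t ht hφt)
    rw [slope_def_field, add_sub_cancel_left, div_one] at h3
    linarith

/-! ### From a common copula to rescaled tails -/

namespace IsSmoothSurvival

variable {φ f g : ℝ → ℝ}

theorem density_pos_iff (h : IsSmoothSurvival φ f g) {t : ℝ} (ht : 0 < t) : 0 < f t ↔ 0 < φ t :=
  ⟨h.hasSurvivalDensity.pos_of_density_pos ht, h.density_pos t ht⟩

theorem hasDerivAt_tail (h : IsSmoothSurvival φ f g) {t : ℝ} (ht : 0 < t) (hφ : 0 < φ t) :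
    HasDerivAt (fun s => f (t + s) / f t) (-(g t / f t)) 0 := by
  have h1 : HasDerivAt f (-g t) (t + 0) := by
    rw [add_zero]
    exact h.hasDerivAt_density t ht hφ
  simpa [neg_div] using (h1.comp_const_add t 0).div_const (f t)

/-- If almost all tails generate the same bivariate copula, all of them are rescalings of each
other. -/
theorem tail_eq_of_copula (h : IsSmoothSurvival φ f g) {C : ℝ → ℝ → ℝ}
    (hC : ∀ᵐ t ∂(volume : Measure ℝ), 0 < t → 0 < f t →
      ∀ a b, 0 ≤ a → 0 ≤ b → 0 < φ a → 0 < φ b →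
        C (f (t + a) / f t) (f (t + b) / f t) = f (t + (a + b)) / f t)
    {t t' a : ℝ} (ht : 0 < t ∧ 0 < φ t) (ht' : 0 < t' ∧ 0 < φ t') (ha : 0 ≤ a) :
    f (t + a) / f t = f (t' + f t' / g t' * (a / (f t / g t))) / f t' := by
  set S : Set ℝ := {t | 0 < t ∧ 0 < φ t} with hS
  have hSo : IsOpen S := h.isSurvival.isOpen_pos
  have hfS : ∀ t ∈ S, 0 < f t := fun t ht => h.density_pos t ht.1 ht.2
  have hgS : ∀ t ∈ S, 0 < g t := fun t ht => h.neg_deriv_pos t ht.1 ht.2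
  let Q : ℝ → Prop := fun t => ∀ a b, 0 ≤ a → 0 ≤ b → 0 < f (t + a) / f t → 0 < f (t + b) / f t →
    C (f (t + a) / f t) (f (t + b) / f t) = f (t + (a + b)) / f t
  have hQ : ∀ᵐ t ∂(volume.restrict S), Q t := by
    rw [ae_restrict_iff' hSo.measurableSet]
    filter_upwards [hC] with t ht htS a b ha hb hfa hfb
    have key : ∀ x, 0 ≤ x → 0 < f (t + x) / f t → 0 < φ x := by
      intro x hx hfx
      have h1 : 0 < φ (t + x) := (h.density_pos_iff (add_pos_of_pos_of_nonneg htS.1 hx)).1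
        ((div_pos_iff_of_pos_right (hfS t htS)).1 hfx)
      exact h1.trans_le (h.isSurvival.antitoneOn hx
        (mem_Ici.2 (add_nonneg htS.1.le hx)) (by linarith [htS.1]))
    exact ht htS.1 (hfS t htS) a b ha hb (key a ha hfa) (key b hb hfb)
  have hpair : ∀ t ∈ S, ∀ t' ∈ S, Q t → Q t' → ∀ a w, 0 ≤ a → 0 ≤ w → 0 < f (t + a) / f t →
      f (t + a) / f t = f (t' + w) / f t' → w = f t' / g t' * (a / (f t / g t)) := by
    intro t ht t' ht' hQt hQt' a w ha hw hp heq
    have := (h.tail t ht.1 (hfS t ht)).mul_eq_mul_of_copula_eq (h.tail t' ht'.1 (hfS t' ht'))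
      hQt hQt' (h.hasDerivAt_tail ht.1 ht.2) (h.hasDerivAt_tail ht'.1 ht'.2) ha hw hp heq
    have h1 := hfS t ht
    have h2 := hfS t' ht'
    have h3 := hgS t ht
    have h4 := hgS t' ht'
    field_simp at this ⊢
    linarith
  have hgood : ∀ t ∈ S, ∀ t' ∈ S, Q t → Q t' → ∀ a, 0 ≤ a →
      f (t + a) / f t = f (t' + f t' / g t' * (a / (f t / g t))) / f t' := by
    intro t ht t' ht' hQt hQt' a ha
    have h1 := hfS t ht
    have h2 := hfS t' ht'
    have h3 := hgS t ht
    have h4 := hgS t' ht'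
    have hH := h.tail t ht.1 h1
    have hH' := h.tail t' ht'.1 h2
    have hw : 0 ≤ f t' / g t' * (a / (f t / g t)) := by positivity
    rcases (hH.nonneg a ha).lt_or_eq with hp | hp
    · obtain ⟨w, hw, hweq⟩ := hH'.exists_eq ⟨hp, hH.le_one ha⟩
      rw [← hpair t ht t' ht' hQt hQt' a w ha hw hp hweq.symm]
      exact hweq.symm
    -- Where the tail at t has vanished, the other one must vanish too: otherwise the same argument
    -- with t and t' exchanged finds b with positive tail and b = a.
    · rcases (hH'.nonneg _ hw).lt_or_eq with hp' | hp'
      · obtain ⟨b, hb, hbeq⟩ := hH.exists_eq ⟨hp', hH'.le_one hw⟩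
        have := hpair t' ht' t ht hQt' hQt _ b hw hb hp' hbeq.symm
        have hba : b = a := by
          rw [this]
          field_simp
        rw [← hba]
        rw [hba] at hbeq ⊢
        exact hbeq
      · exact hp.symm.trans hp'
  have hcont : ∀ t' ∈ S, ∀ a, 0 ≤ a →
      ContinuousOn (fun t => f (t + a) / f t) S ∧
      ContinuousOn (fun t => f (t' + f t' / g t' * (a / (f t / g t))) / f t') S := by
    intro t' ht' a ha
    have hfc : ContinuousOn f S :=
      h.hasSurvivalDensity.density_continuousOn.mono fun t ht => ht.1
    have hgc : ContinuousOn g S := h.neg_deriv_continuousOn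
    have h2 := hfS t' ht'
    have h4 := hgS t' ht'
    refine ⟨ContinuousOn.div ?_ hfc fun t ht => (hfS t ht).ne', ContinuousOn.div_const ?_ _⟩
    · exact h.hasSurvivalDensity.density_continuousOn.comp (by fun_prop) fun t ht =>
        add_pos_of_pos_of_nonneg ht.1 ha
    · refine h.hasSurvivalDensity.density_continuousOn.comp ?_ fun t ht => ?_
      · refine continuousOn_const.add (continuousOn_const.mul (continuousOn_const.div
          (hfc.div hgc fun t ht => (hgS t ht).ne') fun t ht =>
            (div_pos (hfS t ht) (hgS t ht)).ne'))
      · have h1 := hfS t ht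
        have h3 := hgS t ht
        exact add_pos_of_pos_of_nonneg ht'.1 (by positivity)
  obtain ⟨t₀, ht₀, hQ₀⟩ : ∃ t₀ ∈ S, Q t₀ := by
    have hne : NeBot (ae (volume.restrict S)) := by
      rw [ae_neBot, Ne, Measure.restrict_eq_zero]
      exact (hSo.measure_pos volume ⟨t, ht⟩).ne'
    exact ((ae_restrict_mem hSo.measurableSet).and hQ).exists
  -- Both sides are continuous in t on the open set S, the right one because g is continuous, so
  -- equality almost everywhere is equality everywhere. The fixed good point t₀ serves as
  -- intermediary for arbitrary t and t'.
  have hall : ∀ t ∈ S, ∀ a, 0 ≤ a →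
      f (t + a) / f t = f (t₀ + f t₀ / g t₀ * (a / (f t / g t))) / f t₀ := by
    intro t ht a ha
    refine Measure.eqOn_open_of_ae_eq (μ := volume) ?_ hSo (hcont t₀ ht₀ a ha).1
      (hcont t₀ ht₀ a ha).2 ht
    filter_upwards [hQ, ae_restrict_mem hSo.measurableSet] with s hs hsS
    exact hgood s hsS t₀ ht₀ hs hQ₀ a ha
  have h1 := hfS t ht
  have h2 := hfS t' ht'
  have h3 := hgS t ht
  have h4 := hgS t' ht'
  rw [hall t ht a ha, hall t' ht' _ (by positivity)]
  congr 3
  field_simp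

end IsSmoothSurvival

theorem eq_of_hasDerivAt_eq_zero {F : ℝ → ℝ} {a b : ℝ} (hab : a ≤ b)
    (hcont : ContinuousOn F (Icc a b)) (hder : ∀ x ∈ Ioo a b, HasDerivAt F 0 x) : F a = F b := by
  rcases hab.eq_or_lt with rfl | hab
  · rfl
  · obtain ⟨c, -, hc⟩ := exists_hasDerivAt_eq_slope F (fun _ => 0) hab hcont hder
    rw [eq_div_iff (sub_pos.2 hab).ne', zero_mul] at hc
    linarith

theorem IsSurvival.exists_endpoint {φ : ℝ → ℝ} (h : IsSurvival φ) (hz : ∃ s, 0 ≤ s ∧ φ s = 0) :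
    ∃ s₀, 0 < s₀ ∧ (∀ s, 0 ≤ s → s < s₀ → 0 < φ s) ∧ ∀ s, s₀ ≤ s → φ s = 0 := by
  set S : Set ℝ := Ici 0 ∩ φ ⁻¹' {0} with hS
  have hclosed : IsClosed S := h.continuousOn.preimage_isClosed_of_isClosed isClosed_Ici
    isClosed_singleton
  have hbdd : BddBelow S := ⟨0, fun s hs => hs.1⟩
  have hmem : sInf S ∈ S := hclosed.csInf_mem hz hbdd
  refine ⟨sInf S, lt_of_le_of_ne hmem.1 fun h0 => ?_, fun s hs hlt => ?_, fun s hs => ?_⟩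
  · have h1 : φ (sInf S) = 0 := hmem.2
    rw [← h0, h.map_zero] at h1
    exact one_ne_zero h1
  · exact lt_of_le_of_ne (h.nonneg s hs) fun h0 => (csInf_le hbdd ⟨hs, h0.symm⟩).not_gt hlt
  · have h0 : 0 ≤ s := le_trans hmem.1 hs
    have h1 : φ (sInf S) = 0 := hmem.2
    exact le_antisymm (h1 ▸ h.antitoneOn hmem.1 h0 hs) (h.nonneg s h0)

/-! ### The scale f / g is affine -/

namespace IsSmoothSurvival

variable {φ f g : ℝ → ℝ}

/-- All tails of the density are rescalings of each other, with the scale `f / g`. -/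
def TailsRescale (φ f g : ℝ → ℝ) : Prop :=
  ∀ t t' a, (0 < t ∧ 0 < φ t) → (0 < t' ∧ 0 < φ t') → 0 ≤ a →
    f (t + a) / f t = f (t' + f t' / g t' * (a / (f t / g t))) / f t'

/-- The tail at t first vanishes at s₀ - t. A rescaling matches these endpoints, so (s₀ - t) divided
by the scale f(t)/g(t) is a constant κ. -/
theorem exists_affine_of_endpoint (h : IsSmoothSurvival φ f g) (hT : TailsRescale φ f g) {s₀ : ℝ}
    (hs₀ : 0 < s₀) (hpos : ∀ s, 0 ≤ s → s < s₀ → 0 < φ s) (hzero : ∀ s, s₀ ≤ s → φ s = 0) :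
    ∃ κ, 0 < κ ∧ ∀ t, 0 < t → t < s₀ → f t = g t * ((s₀ - t) / κ) := by
  have hf0 : ∀ t, s₀ ≤ t → f t = 0 := by
    intro t ht
    have ht0 := hs₀.trans_le ht
    refine le_antisymm ?_ (h.hasSurvivalDensity.density_nonneg t ht0)
    by_contra! hft
    exact ((h.density_pos_iff ht0).1 hft).ne' (hzero t ht)
  have hfp : ∀ t, 0 < t → t < s₀ → 0 < f t := fun t ht hts => h.density_pos t ht (hpos t ht.le hts)
  have hgp : ∀ t, 0 < t → t < s₀ → 0 < g t := fun t ht hts =>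
    h.neg_deriv_pos t ht (hpos t ht.le hts)
  have key : ∀ t t', 0 < t → t < s₀ → 0 < t' → t' < s₀ →
      (s₀ - t') / (f t' / g t') ≤ (s₀ - t) / (f t / g t) := by
    intro t t' ht hts ht' hts'
    have h1 := hfp t ht hts
    have h2 := hgp t ht hts
    have h3 := hfp t' ht' hts'
    have h4 := hgp t' ht' hts'
    have h5 := hT t t' (s₀ - t) ⟨ht, hpos t ht.le hts⟩ ⟨ht', hpos t' ht'.le hts'⟩
      (sub_nonneg.2 hts.le)
    rw [add_sub_cancel, hf0 s₀ le_rfl, zero_div] at h5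
    rw [div_le_iff₀ (div_pos h3 h4)]
    by_contra! hlt
    have h6 : 0 < s₀ - t := sub_pos.2 hts
    have h7 := hfp (t' + f t' / g t' * ((s₀ - t) / (f t / g t))) (by positivity) (by linarith)
    exact (div_pos h7 h3).ne h5
  have hh : 0 < s₀ / 2 ∧ s₀ / 2 < s₀ := ⟨half_pos hs₀, half_lt_self hs₀⟩
  have h1 := hfp _ hh.1 hh.2
  have h2 := hgp _ hh.1 hh.2
  refine ⟨(s₀ - s₀ / 2) / (f (s₀ / 2) / g (s₀ / 2)),
    div_pos (sub_pos.2 hh.2) (div_pos h1 h2), fun t ht hts => ?_⟩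
  have heq := le_antisymm (key t _ ht hts hh.1 hh.2) (key _ t hh.1 hh.2 ht hts)
  have h3 := hfp t ht hts
  have h4 := hgp t ht hts
  have h5 : 0 < s₀ - t := sub_pos.2 hts
  rw [heq]
  field_simp

/-- Differentiating the tail relation in a, and dividing the relation by its derivative, gives an
equation for q = f/g alone. For fixed t', the function v ↦ q(t' + q(t') v) / q(t') then solves the
Gołąb–Schinzel equation. -/
theorem exists_affine_of_pos (h : IsSmoothSurvival φ f g) (hT : TailsRescale φ f g)
    (hpos : ∀ s, 0 ≤ s → 0 < φ s) :
    ∃ α β, ∀ t, 0 < t → 0 < α + β * t ∧ f t = g t * (α + β * t) := by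
  have hfp : ∀ t, 0 < t → 0 < f t := fun t ht => h.density_pos t ht (hpos t ht.le)
  have hgp : ∀ t, 0 < t → 0 < g t := fun t ht => h.neg_deriv_pos t ht (hpos t ht.le)
  set q : ℝ → ℝ := fun t => f t / g t with hq
  have hqp : ∀ t, 0 < t → 0 < q t := fun t ht => div_pos (hfp t ht) (hgp t ht)
  have hqc : ContinuousOn q (Ioi 0) := by
    refine h.hasSurvivalDensity.density_continuousOn.div
      (h.neg_deriv_continuousOn.mono fun t ht => ⟨ht, hpos t (le_of_lt ht)⟩) fun t ht => ?_
    exact (hgp t ht).ne'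
  have hfd : ∀ t, 0 < t → HasDerivAt f (-g t) t := fun t ht =>
    h.hasDerivAt_density t ht (hpos t ht.le)
  -- differentiating the relation between two tails
  have hqrel : ∀ t t' a, 0 < t → 0 < t' → 0 ≤ a →
      q (t + a) = q t / q t' * q (t' + q t' * (a / q t)) := by
    intro t t' a ht ht' ha
    have hqt := hqp t ht
    have hqt' := hqp t' ht'
    rcases ha.eq_or_lt with rfl | ha
    · rw [zero_div, mul_zero, add_zero, add_zero]
      field_simp
    have htail : ∀ x, 0 ≤ x → f (t + x) / f t = f (t' + q t' * (x / q t)) / f t' := fun x hx =>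
      hT t t' x ⟨ht, hpos t ht.le⟩ ⟨ht', hpos t' ht'.le⟩ hx
    have harg : 0 < t' + q t' * (a / q t) := by positivity
    have hd1 : HasDerivAt (fun x => f (t + x) / f t) (-g (t + a) / f t) a :=
      ((hfd (t + a) (by positivity)).comp_const_add t a).div_const _
    have hlin : HasDerivAt (fun x => t' + q t' * (x / q t)) (q t' * (1 / q t)) a :=
      (((hasDerivAt_id a).div_const (q t)).const_mul (q t')).const_add t'
    have hd2 : HasDerivAt (fun x => f (t' + q t' * (x / q t)) / f t')
        (-g (t' + q t' * (a / q t)) * (q t' * (1 / q t)) / f t') a :=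
      (HasDerivAt.comp a (h₂ := f) (hfd _ harg) hlin).div_const _
    have heq : (fun x => f (t + x) / f t) =ᶠ[𝓝 a] fun x => f (t' + q t' * (x / q t)) / f t' := by
      filter_upwards [Ioi_mem_nhds ha] with x hx
      exact htail x (le_of_lt hx)
    have hderiv := hd1.unique (hd2.congr_of_eventuallyEq heq)
    have hval := htail a ha.le
    have h1 := hfp t ht
    have h2 := hfp t' ht'
    have h3 := hgp (t + a) (by positivity)
    have h4 := hgp _ harg
    have e1 : f (t + a) = f (t' + q t' * (a / q t)) / f t' * f t := by
      rw [← hval, div_mul_cancel₀ _ h1.ne']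
    have e2 : g (t + a) = g (t' + q t' * (a / q t)) * (q t' * (1 / q t)) / f t' * f t := by
      rw [neg_mul, neg_div, neg_div, neg_inj] at hderiv
      rw [← hderiv, div_mul_cancel₀ _ h1.ne']
    change f (t + a) / g (t + a) =
      q t / q t' * (f (t' + q t' * (a / q t)) / g (t' + q t' * (a / q t)))
    rw [e1, e2]
    field_simp
  -- The base point t' stays positive because q is not known to extend continuously to 0; the slopes
  -- for different base points agree on the overlaps.
  have haff : ∀ t', 0 < t' → ∃ c, ∀ s, t' ≤ s → q s = q t' + c * (s - t') := by
    intro t' ht'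
    have hqt' := hqp t' ht'
    have harg : ∀ v, 0 ≤ v → 0 < t' + q t' * v := fun v hv => by positivity
    obtain ⟨c, hc⟩ := golab_schinzel (M := fun v => q (t' + q t' * v) / q t')
      ((hqc.comp (by fun_prop) fun v hv => harg v hv).div_const _)
      (fun v hv => div_pos (hqp _ (harg v hv)) hqt') fun u v hu hv => by
        have ht := harg v hv
        have h1 := hqp _ ht
        have h2 := hqrel (t' + q t' * v) t' (u * q (t' + q t' * v)) ht ht' (by positivity)
        rw [mul_div_cancel_right₀ _ h1.ne'] at h2
        have h3 : t' + q t' * (v + u * (q (t' + q t' * v) / q t')) =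
            t' + q t' * v + u * q (t' + q t' * v) := by
          field_simp
          ring
        simp only [h3, h2]
        field_simp
    refine ⟨c, fun s hs => ?_⟩
    have h1 := hc ((s - t') / q t') (div_nonneg (sub_nonneg.2 hs) hqt'.le)
    rw [mul_div_cancel₀ _ hqt'.ne', add_sub_cancel, div_eq_iff hqt'.ne'] at h1
    rw [h1]
    field_simp
  choose! c hc using haff
  have hcc : ∀ t t', 0 < t → t ≤ t' → c t = c t' := by
    intro t t' ht htt'
    have h1 := hc t ht (t' + 1) (by linarith)
    have h2 := hc t ht t' htt'
    have h3 := hc t' (ht.trans_le htt') (t' + 1) (by linarith)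
    linarith
  have hform : ∀ t, 0 < t → q t = (q 1 - c 1) + c 1 * t := by
    intro t ht
    rcases le_total t 1 with ht1 | ht1
    · have h1 := hc t ht 1 ht1
      rw [hcc t 1 ht ht1] at h1
      linarith
    · have h1 := hc 1 one_pos t ht1
      linarith
  refine ⟨q 1 - c 1, c 1, fun t ht => ?_⟩
  rw [← hform t ht]
  exact ⟨hqp t ht, (mul_div_cancel₀ _ (hgp t ht).ne').symm⟩

end IsSmoothSurvival

/-! ### Integration of the differential equation -/

namespace IsSmoothSurvival

variable {φ f g : ℝ → ℝ} {α β : ℝ}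

/-- A first integral of f = g (α + βt), using φ' = -f and f' = -g; it lowers the order of the
equation by one. -/
theorem hasDerivAt_energy (h : IsSmoothSurvival φ f g) {t : ℝ} (ht : 0 < t) (hφ : 0 < φ t)
    (hfg : f t = g t * (α + β * t)) :
    HasDerivAt (fun s => f s * (α + β * s) - (1 - β) * φ s) 0 t := by
  have hlin : HasDerivAt (fun s => α + β * s) β t := by
    simpa using ((hasDerivAt_id t).const_mul β).const_add α
  have h1 := ((h.hasDerivAt_density t ht hφ).mul hlin).sub
    ((h.hasSurvivalDensity.hasDerivAt t ht).const_mul (1 - β))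
  convert! h1 using 1
  linear_combination -hfg

/-- Integration of `φ' = -(1 - β) φ / (α + β s)`. -/
theorem apply_mul_rpow_eq (h : IsSmoothSurvival φ f g) (hβ : β ≠ 0) {t : ℝ} (ht : 0 < t)
    (hbase : ∀ s, 0 < s → s ≤ t → 0 < α + β * s)
    (hode : ∀ s, 0 < s → s ≤ t → f s * (α + β * s) = (1 - β) * φ s)
    (hα : α ≠ 0 ∨ 0 ≤ (1 - β) / β) :
    φ t * (α + β * t) ^ ((1 - β) / β) = α ^ ((1 - β) / β) := by
  set e := (1 - β) / β with he
  have hcont : ContinuousOn (fun s => φ s * (α + β * s) ^ e) (Icc 0 t) := by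
    refine (h.isSurvival.continuousOn.mono Icc_subset_Ici_self).mul
      (ContinuousOn.rpow_const (by fun_prop) fun s hs => ?_)
    -- At s = 0 the base of the power is α, which may be 0; continuity there is what the hypothesis
    -- on α provides.
    rcases hs.1.eq_or_lt with rfl | hs0
    · simpa using hα
    · exact Or.inl (hbase s hs0 hs.2).ne'
  have := eq_of_hasDerivAt_eq_zero ht.le hcont fun s hs => by
    have hb := hbase s hs.1 hs.2.le
    have hlin : HasDerivAt (fun s => α + β * s) β s := by
      simpa using ((hasDerivAt_id s).const_mul β).const_add α
    have h1 := (h.hasSurvivalDensity.hasDerivAt s hs.1).mul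
      (hlin.rpow_const (p := e) (Or.inl hb.ne'))
    convert! h1 using 1
    have h2 : (α + β * s) ^ e = (α + β * s) ^ (e - 1) * (α + β * s) := by
      rw [Real.rpow_sub_one hb.ne', div_mul_cancel₀ _ hb.ne']
    have h3 : β * e = 1 - β := by rw [he, mul_div_cancel₀ _ hβ]
    rw [h2]
    linear_combination (α + β * s) ^ (e - 1) * hode s hs.1 hs.2.le -
      φ s * (α + β * s) ^ (e - 1) * h3
  simpa [h.isSurvival.map_zero] using this.symm

theorem apply_eq_rpow (h : IsSmoothSurvival φ f g) (hβ : β ≠ 0) (hα : 0 < α) {t : ℝ} (ht : 0 < t)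
    (hbase : ∀ s, 0 < s → s ≤ t → 0 < α + β * s)
    (hode : ∀ s, 0 < s → s ≤ t → f s * (α + β * s) = (1 - β) * φ s) :
    φ t = (1 + β / α * t) ^ (-((1 - β) / β)) := by
  have h1 := h.apply_mul_rpow_eq hβ ht hbase hode (Or.inl hα.ne')
  have hb := hbase t ht le_rfl
  have h2 : 1 + β / α * t = (α + β * t) / α := by field_simp
  have h3 : 0 < (α + β * t) ^ ((1 - β) / β) := Real.rpow_pos_of_pos hb _
  rw [h2, Real.rpow_neg (div_pos hb hα).le, Real.div_rpow hb.le hα.le, inv_div, ← h1,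
    mul_div_cancel_right₀ _ h3.ne']

/-- Here α = s₀/κ and β = -1/κ. The first integral vanishes at s₀ together with φ and f, and the
exponent -(1 - β)/β equals κ + 1. -/
theorem exists_clayton_of_endpoint (h : IsSmoothSurvival φ f g) (hT : TailsRescale φ f g) {s₀ : ℝ}
    (hs₀ : 0 < s₀) (hpos : ∀ s, 0 ≤ s → s < s₀ → 0 < φ s) (hzero : ∀ s, s₀ ≤ s → φ s = 0) :
    ∃ p : ℝ, 0 < p ∧ ∀ s, 0 ≤ s → φ s = (max 0 (1 - s / s₀)) ^ p := by
  obtain ⟨κ, hκ, hfg⟩ := h.exists_affine_of_endpoint hT hs₀ hpos hzero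
  have hlin : ∀ t, s₀ / κ + -(1 / κ) * t = (s₀ - t) / κ := fun t => by ring
  have hf0 : f s₀ = 0 := by
    refine le_antisymm ?_ (h.hasSurvivalDensity.density_nonneg s₀ hs₀)
    by_contra! hft
    exact ((h.density_pos_iff hs₀).1 hft).ne' (hzero s₀ le_rfl)
  have hode : ∀ t, 0 < t → t < s₀ →
      f t * (s₀ / κ + -(1 / κ) * t) = (1 - -(1 / κ)) * φ t := by
    intro t ht hts
    have hcont : ContinuousOn
        (fun s => f s * (s₀ / κ + -(1 / κ) * s) - (1 - -(1 / κ)) * φ s) (Icc t s₀) := by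
      refine ContinuousOn.sub (ContinuousOn.mul ?_ (by fun_prop)) (continuousOn_const.mul ?_)
      · exact h.hasSurvivalDensity.density_continuousOn.mono fun s hs => ht.trans_le hs.1
      · exact h.isSurvival.continuousOn.mono fun s hs => ht.le.trans hs.1
    have := eq_of_hasDerivAt_eq_zero hts.le hcont fun s hs =>
      h.hasDerivAt_energy (ht.trans hs.1) (hpos s (ht.trans hs.1).le hs.2)
        (by rw [hlin]; exact hfg s (ht.trans hs.1) hs.2)
    simp only [hf0, hzero s₀ le_rfl, zero_mul, mul_zero, sub_zero] at this
    exact sub_eq_zero.1 this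
  refine ⟨κ + 1, by positivity, fun s hs => ?_⟩
  rcases lt_or_ge s s₀ with hlt | hge
  · have hb : 0 < 1 - s / s₀ := by rw [sub_pos, div_lt_one hs₀]; exact hlt
    rw [max_eq_right hb.le]
    rcases hs.eq_or_lt with rfl | hs
    · simp [h.isSurvival.map_zero]
    · have := h.apply_eq_rpow (α := s₀ / κ) (β := -(1 / κ)) (by simp [hκ.ne'])
        (div_pos hs₀ hκ) hs
        (fun x _ hx => by rw [hlin]; exact div_pos (by linarith) hκ)
        fun x hx hxs => hode x hx (hxs.trans_lt hlt)
      rw [this]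
      congr 1
      · field_simp
        ring
      · field_simp
        ring
  · have : 1 - s / s₀ ≤ 0 := by rw [sub_nonpos, one_le_div hs₀]; exact hge
    rw [max_eq_left this, Real.zero_rpow (by positivity), hzero s hge]

theorem exists_clayton_of_pos (h : IsSmoothSurvival φ f g) (hT : TailsRescale φ f g)
    (hpos : ∀ s, 0 ≤ s → 0 < φ s) :
    ∃ θ c, 0 ≤ θ ∧ 0 < c ∧ ∀ s, 0 ≤ s → φ s = mtcjGenerator θ (c * s) := by
  obtain ⟨α, β, hab⟩ := h.exists_affine_of_pos hT hpos
  have hode : ∀ t, 0 < t → f t * (α + β * t) = (1 - β) * φ t := by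
    intro t ht
    set F : ℝ → ℝ := fun s => f s * (α + β * s) - (1 - β) * φ s with hF
    have hFd : ∀ s, 0 < s → HasDerivAt F 0 s := fun s hs =>
      h.hasDerivAt_energy hs (hpos s hs.le) (hab s hs).2
    have hconst : ∀ u, t ≤ u → F t = F u := fun u hu =>
      eq_of_hasDerivAt_eq_zero hu
        (fun s hs => (hFd s (ht.trans_le hs.1)).continuousAt.continuousWithinAt)
        fun s hs => hFd s (ht.trans hs.1)
    -- The constant is read off at infinity, where f, t f(t) and φ all tend to 0.
    have hlim : Tendsto F atTop (𝓝 0) := by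
      have h1 : Tendsto f atTop (𝓝 0) := by
        refine squeeze_zero' ?_ ?_ h.tendsto_mul_density
        · filter_upwards [eventually_gt_atTop 0] with s hs
          exact h.hasSurvivalDensity.density_nonneg s hs
        · filter_upwards [eventually_ge_atTop 1] with s hs
          exact le_mul_of_one_le_left
            (h.hasSurvivalDensity.density_nonneg s (by linarith)) hs
      have h2 := ((h1.const_mul α).add (h.tendsto_mul_density.const_mul β)).sub
        (h.isSurvival.tendsto_zero.const_mul (1 - β))
      simp only [mul_zero, add_zero, sub_zero] at h2
      refine h2.congr fun s => ?_
      rw [hF]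
      ring
    have h0 : F t = 0 := by
      refine tendsto_nhds_unique (tendsto_const_nhds.congr' ?_) hlim
      filter_upwards [eventually_ge_atTop t] with u hu
      exact hconst u hu
    exact sub_eq_zero.1 h0
  have hβ1 : 0 < 1 - β := by
    have h1 := mul_pos (h.density_pos 1 one_pos (hpos 1 zero_le_one)) (hab 1 one_pos).1
    rw [hode 1 one_pos] at h1
    exact (pos_iff_pos_of_mul_pos h1).2 (hpos 1 zero_le_one)
  -- A negative β would make α + βt negative for large t; at the chosen point βt = -(|α| + 1).
  have hβ0 : 0 ≤ β := by
    by_contra! hneg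
    have h1 : 0 < (|α| + 1) / -β := div_pos (by positivity) (neg_pos.2 hneg)
    have h2 := (hab _ h1).1
    have h3 : β * ((|α| + 1) / -β) = -(|α| + 1) := by
      rw [div_neg, mul_neg, mul_div_cancel₀ _ hneg.ne]
    rw [h3] at h2
    linarith [le_abs_self α]
  rcases hβ0.eq_or_lt with rfl | hβ
  · have hα : 0 < α := by simpa using (hab 1 one_pos).1
    refine ⟨0, 1 / α, le_rfl, by positivity, fun t ht => ?_⟩
    rw [mtcjGenerator, if_pos rfl]
    have hlin : ∀ s : ℝ, HasDerivAt (fun s => 1 / α * s) (1 / α) s := fun s => by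
      simpa using (hasDerivAt_id s).const_mul (1 / α)
    have hK := eq_of_hasDerivAt_eq_zero (F := fun s => φ s * Real.exp (1 / α * s)) ht
      ((h.isSurvival.continuousOn.mono Icc_subset_Ici_self).mul (by fun_prop)) fun s hs => by
        have h1 := (h.hasSurvivalDensity.hasDerivAt s hs.1).mul (hlin s).exp
        convert! h1 using 1
        have h2 := hode s hs.1
        rw [zero_mul, add_zero, sub_zero, one_mul] at h2
        rw [← h2]
        field_simp
        ring
    simp only [mul_zero, Real.exp_zero, h.isSurvival.map_zero, mul_one] at hK
    rw [Real.exp_neg]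
    exact eq_inv_of_mul_eq_one_left hK.symm
  · have he : 0 < (1 - β) / β := div_pos hβ1 hβ
    have hα0 : 0 ≤ α := by
      by_contra! hneg
      have h1 := (hab (-α / β) (div_pos (neg_pos.2 hneg) hβ)).1
      rw [mul_div_cancel₀ _ hβ.ne', add_neg_cancel] at h1
      exact lt_irrefl _ h1
    -- If α were 0, then φ(1) β^((1-β)/β) would equal its value at 0, which is 0 because φ(0) = 1 is
    -- finite; but φ and β are positive.
    have hα : 0 < α := by
      refine lt_of_le_of_ne hα0 fun h0 => ?_
      have h1 := h.apply_mul_rpow_eq hβ.ne' one_pos (fun s hs _ => (hab s hs).1)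
        (fun s hs _ => hode s hs) (Or.inr he.le)
      rw [← h0, Real.zero_rpow he.ne'] at h1
      have h2 := (hab 1 one_pos).1
      rw [← h0] at h2
      exact (mul_pos (hpos 1 zero_le_one) (Real.rpow_pos_of_pos h2 _)).ne' h1
    -- Matching (1 + (β/α) t)^(-(1-β)/β) requires -1/θ = -(1-β)/β and θc = β/α.
    refine ⟨β / (1 - β), (1 - β) / α, (div_pos hβ hβ1).le, div_pos hβ1 hα, fun t ht => ?_⟩
    rw [mtcjGenerator, if_neg (div_pos hβ hβ1).ne']
    have h1 : 1 + β / (1 - β) * ((1 - β) / α * t) = 1 + β / α * t := by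
      field_simp
    have h2 : -1 / (β / (1 - β)) = -((1 - β) / β) := by
      field_simp
    have h3 : 0 < 1 + β / α * t := by positivity
    rw [h1, h2, max_eq_right h3.le]
    rcases ht.eq_or_lt with rfl | ht
    · simp [h.isSurvival.map_zero]
    · exact h.apply_eq_rpow hβ.ne' hα ht (fun s hs _ => (hab s hs).1) fun s hs _ => hode s hs

end IsSmoothSurvival

/-! ### Conclusion -/

theorem IsArchimedeanGenerator.isMTCJ_of_tailsRescale {d : ℕ} {φ f g : ℝ → ℝ} (hd : 3 ≤ d)
    (hφ : IsArchimedeanGenerator d φ) (h : IsSmoothSurvival φ f g)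
    (hT : IsSmoothSurvival.TailsRescale φ f g) : IsMTCJ d φ := by
  have hd1 : (0 : ℝ) < (d : ℝ) - 1 := by
    have : (3 : ℝ) ≤ d := by exact_mod_cast hd
    linarith
  by_cases hz : ∃ s, 0 ≤ s ∧ φ s = 0
  · obtain ⟨s₀, hs₀, hpos, hzero⟩ := h.isSurvival.exists_endpoint hz
    obtain ⟨p, hp, hform⟩ := h.exists_clayton_of_endpoint hT hs₀ hpos hzero
    have hpd := hφ.le_exponent (by omega) hs₀ hp hform
    -- The exponent p is -1/θ and the endpoint s₀ is -1/(θc); p ≥ d - 1 becomes the lower bound on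
    -- θ.
    refine ⟨-1 / p, p / s₀, ?_, by positivity, fun s hs => ?_⟩
    · rw [neg_div, neg_div, neg_le_neg_iff]
      exact one_div_le_one_div_of_le hd1 hpd
    · have hne : -1 / p ≠ 0 := div_ne_zero (by norm_num) hp.ne'
      rw [mtcjGenerator, if_neg hne, hform s hs]
      congr 2
      · field_simp
        ring
      · field_simp
  · push Not at hz
    obtain ⟨θ, c, hθ, hc, hform⟩ := h.exists_clayton_of_pos hT fun s hs =>
      lt_of_le_of_ne (h.isSurvival.nonneg s hs) (hz s hs).symm
    exact ⟨θ, c, (div_neg_of_neg_of_pos (by norm_num) hd1).le.trans hθ, hc, hform⟩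

theorem mainTheorem1 (d : ℕ) (hd : 3 ≤ d) (φ : ℝ → ℝ) (hφ : IsArchimedeanGenerator d φ) :
    (4 ≤ d → IsC2WherePos φ) ∧
    (IsC2WherePos φ →
      ∀ (μ : Measure (Fin d → ℝ)) [IsProbabilityMeasure μ], IsArchimedeanCopulaLaw φ μ →
        (IsSimplifiedPCC μ ↔ IsMTCJ d φ) ∧
        (IsMTCJ d φ → ∀ A D : Finset (Fin d), 2 ≤ A.card → D.Nonempty → Disjoint A D →
          ConditionalCopulaConstant μ A D) ∧
        (∀ A D : Finset (Fin d), A.card = 2 → D.card = 1 → Disjoint A D →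
          ConditionalCopulaConstant μ A D → IsMTCJ d φ)) := by
  refine ⟨fun h4 => hφ.isC2WherePos h4, fun hC2 μ _ hμ => ?_⟩
  have hsurv := hφ.isSurvival hd
  have hforward : IsMTCJ d φ → ∀ A D : Finset (Fin d), 2 ≤ A.card → D.Nonempty → Disjoint A D →
      ConditionalCopulaConstant μ A D := fun h A D hA _ hAD =>
    h.conditionalCopulaConstant hsurv hμ hA hAD
  have hback : ∀ A D : Finset (Fin d), A.card = 2 → D.card = 1 → Disjoint A D →
      ConditionalCopulaConstant μ A D → IsMTCJ d φ := by
    intro A D hA hD hAD hconst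
    have hsmooth := hφ.isSmoothSurvival hd hC2
    obtain ⟨C, hC⟩ := hμ.exists_copula_eq hsurv hsmooth.hasSurvivalDensity hA hD hAD hconst
    exact hφ.isMTCJ_of_tailsRescale hd hsmooth fun t t' a ht ht' ha =>
      hsmooth.tail_eq_of_copula hC ht ht' ha
  refine ⟨⟨fun hS => ?_, fun h A D hA hD hAD => hforward h A D hA.ge hD hAD⟩, hforward, hback⟩
  let i₀ : Fin d := ⟨0, by omega⟩
  let i₁ : Fin d := ⟨1, by omega⟩
  let i₂ : Fin d := ⟨2, by omega⟩
  have h01 : i₀ ≠ i₁ := by simp [i₀, i₁]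
  have hA : ({i₀, i₁} : Finset (Fin d)).card = 2 := Finset.card_pair h01
  have hAD : Disjoint ({i₀, i₁} : Finset (Fin d)) {i₂} := by
    simp [i₀, i₁, i₂]
  exact hback _ _ hA (Finset.card_singleton i₂) hAD
    (hS _ _ hA (Finset.singleton_nonempty i₂) hAD)
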